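/- Let $d \ge 2$ and $M \ge 0$ be constants. A central $d$-dimensional array of side length $2n+1$ is an array $A$ with index set $\{-n,\dots,n\}^d$. Central Maximum Subarray Sum asks, given $n \ge 1$ and a central $d$-dimensional array $A$ of side length $2n+1$, for $$\max_{\substack{i \in \{1,\dots,n\}^d,\ \delta \in \{1,\dots,2n\}^d\\ -n \le i-\delta < 0}} \ \sum_{j \in \{0,1\}^d} A[i - \delta \odot j],$$ where $\odot$ is the componentwise product and the inequalities hold in every component. The model is the word RAM with words of $O(\log n)$ bits, unit cost per instruction, and no assumption on the initial contents of memory outside the input; $\tilde O(f(n))$ means $f(n)\cdot\mathrm{polylog}(n)$. We say that $n\times n$ matrices can be multiplied in $\tilde O(T(n))$ time if for every constant $c$ there is an algorithm that multiplies two $n\times n$ integer matrices with entries of absolute value at most $n^{c}$ in $\tilde O(T(n))$ time, and let $\omega$ be the infimum of the real numbers $\tau$ such that $n\times n$ matrices can be multiplied in $\tilde O(n^{\tau})$ time. Then Central Maximum Subarray Sum on central $d$-dimensional arrays all of whose entries are integers of absolute value at most $M$ can be solved in $n^{2d-4+\omega+o(1)}$ time, that is, for every $\varepsilon>0$ there is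 an algorithm solving it in $\tilde O(n^{2d-4+\omega+\varepsilon})$ time. More precisely, for every function $T$, if $n\times n$ matrices can be multiplied in $\tilde O(T(n))$ time, then the problem can be solved in $\tilde O(n^{2d-4}\,T(n))$ time; in particular it can be solved in $\tilde O(n^{2d-4+\omega})$ time if $n \times n$ matrices can be multiplied in $\tilde O(n^{\omega})$ time. -/

import Mathlib

/-! ### A word RAM

Programs work on finitely many scalar registers and finitely many arrays of memory; every register
and every memory cell holds one signed word, an integer of absolute value at most `B`.  An array
cell is addressed by a word held in a register.  Every elementary instruction and every test takes
one step.  An operation whose result does not fit into a word has no execution. -/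

namespace WordRAM

/-- Memory contents: scalar registers, and arrays (array name, then address). -/
structure Store where
  reg : ℕ → ℤ
  mem : ℕ → ℤ → ℤ

namespace Store

/-- Every register and every cell holds a word of absolute value at most `B`. -/
def Fits (B : ℕ) (s : Store) : Prop :=
  (∀ x, (s.reg x).natAbs ≤ B) ∧ ∀ a p, (s.mem a p).natAbs ≤ B

/-- Write `v` to the register `x`. -/
def setReg (s : Store) (x : ℕ) (v : ℤ) : Store :=
  { s with reg := Function.update s.reg x v }

/-- Write `v` to the cell `p` of the array `a`. -/
def setMem (s : Store) (a : ℕ) (p v : ℤ) : Store :=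
  { s with mem := Function.update s.mem a (Function.update (s.mem a) p v) }

end Store

/-- The arithmetic operations of the machine. -/
inductive Op
  | add
  | sub
  | mul
  | div

/-- The value of an operation; division is integer division with remainder
(and `y / 0 = 0`). -/
def Op.eval : Op → ℤ → ℤ → ℤ
  | .add, y, z => y + z
  | .sub, y, z => y - z
  | .mul, y, z => y * z
  | .div, y, z => y / z

/-- Programs. -/
inductive Prog
  /-- no operation -/
  | skip
  /-- `x := c` -/
  | const (x : ℕ) (c : ℤ)
  /-- `x := y op z` for registers `x`, `y`, `z` -/
  | arith (o : Op) (x y z : ℕ)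
  /-- `x := a[y]` for registers `x`, `y` and an array `a` -/
  | load (x a y : ℕ)
  /-- `a[y] := x` for registers `x`, `y` and an array `a` -/
  | store (a y x : ℕ)
  /-- first `p`, then `q` -/
  | seq (p q : Prog)
  /-- if `x > 0` then `p` else `q` -/
  | branch (x : ℕ) (p q : Prog)
  /-- while `x > 0` do `p` -/
  | loop (x : ℕ) (p : Prog)

/-- `Exec B P s t s'`: on the machine whose words are the integers of absolute value at most `B`,
the program `P` started in `s` halts in `s'` after exactly `t` steps. -/
inductive Exec (B : ℕ) : Prog → Store → ℕ → Store → Prop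
  | skip (s : Store) : Exec B .skip s 1 s
  | const (s : Store) (x : ℕ) (c : ℤ) (h : c.natAbs ≤ B) :
      Exec B (.const x c) s 1 (s.setReg x c)
  | arith (s : Store) (o : Op) (x y z : ℕ) (h : (o.eval (s.reg y) (s.reg z)).natAbs ≤ B) :
      Exec B (.arith o x y z) s 1 (s.setReg x (o.eval (s.reg y) (s.reg z)))
  | load (s : Store) (x a y : ℕ) :
      Exec B (.load x a y) s 1 (s.setReg x (s.mem a (s.reg y)))
  | store (s : Store) (a y x : ℕ) :
      Exec B (.store a y x) s 1 (s.setMem a (s.reg y) (s.reg x))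
  | seq {p q : Prog} {s s' s'' : Store} {t t' : ℕ} (hp : Exec B p s t s')
      (hq : Exec B q s' t' s'') : Exec B (.seq p q) s (t + t') s''
  | branch_pos {x : ℕ} {p q : Prog} {s s' : Store} {t : ℕ} (hx : 0 < s.reg x)
      (hp : Exec B p s t s') : Exec B (.branch x p q) s (t + 1) s'
  | branch_neg {x : ℕ} {p q : Prog} {s s' : Store} {t : ℕ} (hx : s.reg x ≤ 0)
      (hq : Exec B q s t s') : Exec B (.branch x p q) s (t + 1) s'
  | loop_done {x : ℕ} {p : Prog} {s : Store} (hx : s.reg x ≤ 0) :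
      Exec B (.loop x p) s 1 s
  | loop_step {x : ℕ} {p : Prog} {s s' s'' : Store} {t t' : ℕ} (hx : 0 < s.reg x)
      (hp : Exec B p s t s') (hl : Exec B (.loop x p) s' t' s'') :
      Exec B (.loop x p) s (t + t' + 1) s''

/-- `SolvableInSoftO inst input output T`: a computational problem is solvable in `Õ(T(n))` time
on a word RAM with words of `O(log n)` bits.

`inst n` is the type of instances of size parameter `n`, `input n X s` says that the store `s`
holds the instance `X`, and `output n X s'` that `s'` holds a correct answer.  One program has to
work for all `n ≥ 1`, for all word lengths of at least `w log (n + 2)` bits, and whatever the part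
of the memory that does not hold the input contains at the start; it has to halt within
`C · T(n) · (log (n + 2)) ^ k` steps. -/
def SolvableInSoftO (inst : ℕ → Type) (input output : (n : ℕ) → inst n → Store → Prop)
    (T : ℕ → ℝ) : Prop :=
  ∃ (P : Prog) (w k : ℕ) (C : ℝ), ∀ n : ℕ, 1 ≤ n → ∀ X : inst n, ∀ B : ℕ, (n + 2) ^ w ≤ B →
    ∀ s : Store, s.Fits B → input n X s →
      ∃ (t : ℕ) (s' : Store), Exec B P s t s' ∧ output n X s' ∧
        (t : ℝ) ≤ C * T n * Real.log (n + 2) ^ k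

end WordRAM

/-! ### Matrix multiplication and its exponent -/

open WordRAM in
/-- The store holds `n` in register `0` and two `n × n` integer matrices, with entries of absolute
value at most `n ^ c`, row by row in the arrays `0` and `1`. -/
def MatMulInput (c n : ℕ) (X : Matrix (Fin n) (Fin n) ℤ × Matrix (Fin n) (Fin n) ℤ)
    (s : Store) : Prop :=
  (∀ i j, (X.1 i j).natAbs ≤ n ^ c ∧ (X.2 i j).natAbs ≤ n ^ c) ∧
  s.reg 0 = n ∧
  ∀ i j : Fin n, s.mem 0 (((i : ℕ) * n + (j : ℕ) : ℕ) : ℤ) = X.1 i j ∧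
    s.mem 1 (((i : ℕ) * n + (j : ℕ) : ℕ) : ℤ) = X.2 i j

open WordRAM in
/-- The array `2` holds the product of the two matrices, row by row. -/
def MatMulOutput (n : ℕ) (X : Matrix (Fin n) (Fin n) ℤ × Matrix (Fin n) (Fin n) ℤ)
    (s : Store) : Prop :=
  ∀ i j : Fin n, s.mem 2 (((i : ℕ) * n + (j : ℕ) : ℕ) : ℤ) = (X.1 * X.2) i j

/-- `n × n` matrices can be multiplied in `Õ(T(n))` time: for every constant `c`, this holds for
integer matrices with entries of absolute value at most `n ^ c`. -/
def MatMulInSoftO (T : ℕ → ℝ) : Prop :=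
  ∀ c : ℕ, WordRAM.SolvableInSoftO
    (fun n => Matrix (Fin n) (Fin n) ℤ × Matrix (Fin n) (Fin n) ℤ)
    (MatMulInput c) MatMulOutput T

/-- The exponent `ω` of square matrix multiplication. -/
noncomputable def matMulExponent : ℝ :=
  sInf {τ : ℝ | MatMulInSoftO (fun n => (n : ℝ) ^ τ)}

/-! ### Central Maximum Subarray Sum

A central `d`-dimensional array of side length `2n + 1` is given by a function on `ℤ ^ d` of which
only the values on `{-n, …, n} ^ d` are ever used. -/

/-- `v` belongs to the index set `{-n, …, n} ^ d`. -/
def InCentralBox {d : ℕ} (n : ℕ) (v : Fin d → ℤ) : Prop :=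
  ∀ r, -(n : ℤ) ≤ v r ∧ v r ≤ n

/-- The corner sums `∑ j ∈ {0,1} ^ d, A[i - δ ⊙ j]` over all `i ∈ {1, …, n} ^ d` and
`δ ∈ {1, …, 2n} ^ d` with `-n ≤ i - δ < 0` in every coordinate. -/
def centralCornerSums {d : ℕ} (n : ℕ) (A : (Fin d → ℤ) → ℤ) : Set ℤ :=
  {v | ∃ i δ : Fin d → ℤ,
    (∀ r, 1 ≤ i r ∧ i r ≤ n) ∧
    (∀ r, 1 ≤ δ r ∧ δ r ≤ 2 * n) ∧
    (∀ r, -(n : ℤ) ≤ i r - δ r ∧ i r - δ r < 0) ∧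
    v = ∑ j : Fin d → Fin 2, A (fun r => i r - δ r * ((j r : ℕ) : ℤ))}

/-- The position of the index `v ∈ {-n, …, n} ^ d` in the listing of the array. -/
def centralAddress {d : ℕ} (n : ℕ) (v : Fin d → ℤ) : ℤ :=
  ∑ r : Fin d, (v r + n) * (2 * n + 1) ^ (r : ℕ)

open WordRAM in
/-- The store holds `n` in register `0` and, in the array `0`, the central array `A`, whose entries
are integers of absolute value at most `M`. -/
def CentralInput (d M n : ℕ) (A : (Fin d → ℤ) → ℤ) (s : Store) : Prop :=
  (∀ v, InCentralBox n v → (A v).natAbs ≤ M) ∧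
  s.reg 0 = n ∧
  ∀ v, InCentralBox n v → s.mem 0 (centralAddress n v) = A v

open WordRAM in
/-- Register `0` holds the central maximum subarray sum of `A`. -/
def CentralOutput (d n : ℕ) (A : (Fin d → ℤ) → ℤ) (s : Store) : Prop :=
  IsGreatest (centralCornerSums n A) (s.reg 0)

/-- Central Maximum Subarray Sum for `d`-dimensional arrays whose entries are integers of absolute
value at most `M` can be solved in `Õ(T(n))` time. -/
def CentralMaxSubarrayInSoftO (d M : ℕ) (T : ℕ → ℝ) : Prop :=
  WordRAM.SolvableInSoftO (fun _ => (Fin d → ℤ) → ℤ) (CentralInput d M) (CentralOutput d) T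

set_option linter.unusedSimpArgs false

/-! In each coordinate `i` and `i - δ` range independently over a positive and a negative index; the
bounds on `δ` then hold by themselves. A corner sum is thus the sum of the `2 ^ d` entries obtained
from one such pair per coordinate, and the coordinates can be peeled off one at a time
(`mem_centralCornerSums_succ`).

For `d = 2`, with the pair `(i, j)` of the first coordinate fixed, the positive and the negative
index of the second coordinate enter separate summands (`mem_centralCornerSums_two`). The two maxima
are therefore independent, and each is an entry of a max-plus product of two quadrants. For entries
of absolute value at most `M`, a max-plus product takes `(2M+1)^2` ordinary products of `0`-`1`
matrices, one per pair of values: the product of the indicator matrices of `a` and `b` shows where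
the sum `a + b` is attained (`runs_maxPlus`). So dimension two costs `Õ(T(n))`.

Each further coordinate is handled by trying its `n ^ 2` pairs, adding the two slices and solving
the smaller problem, whose entries are bounded by `2M` (`runs_centralSucc`). This costs a factor `n
^ 2`, provided that writing the slices is not the bottleneck. It is not: a multiplication algorithm
must write `n ^ 2` cells, so `T` is at least quadratic up to logarithms (`sq_le_of_matMul`). Cubic
multiplication shows that the set defining `ω` is nonempty, which gives the statement with `ε`.

On the machine, a subroutine runs on renamed registers and arrays (`Runs.call`). Its specification
allows arbitrary memory outside its input, so it can be called again on what earlier calls left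
behind. -/

namespace WordRAM

/-! ### Reading, writing and renaming in stores. -/

namespace Store

@[simp] theorem reg_setReg (s : Store) (x y : ℕ) (v : ℤ) :
    (s.setReg x v).reg y = if y = x then v else s.reg y := by
  simp [setReg, Function.update_apply]

/-- The Boolean test lets `Nat.reduceBEq` decide by evaluation which write a read sees; symbolic
execution relies on this form. -/
theorem reg_setReg_beq (s : Store) (x y : ℕ) (v : ℤ) :
    (s.setReg x v).reg y = bif y == x then v else s.reg y := by
  rw [reg_setReg]
  by_cases h : y = x
  · simp [h]
  · simp [h, beq_false_of_ne h]

@[simp] theorem mem_setReg (s : Store) (x : ℕ) (v : ℤ) : (s.setReg x v).mem = s.mem := rfl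

@[simp] theorem reg_setMem (s : Store) (a : ℕ) (p v : ℤ) : (s.setMem a p v).reg = s.reg := rfl

theorem mem_setMem (s : Store) (a b : ℕ) (p q v : ℤ) :
    (s.setMem a p v).mem b q = if b = a ∧ q = p then v else s.mem b q := by
  by_cases h : b = a
  · subst h; simp [setMem, Function.update_apply]
  · simp [setMem, h]

theorem mem_setMem_of_ne (s : Store) {a b : ℕ} (h : b ≠ a) (p v : ℤ) :
    (s.setMem a p v).mem b = s.mem b := by
  simp [setMem, h]

theorem Fits.setReg {B : ℕ} {s : Store} (h : s.Fits B) (x : ℕ) {v : ℤ} (hv : v.natAbs ≤ B) :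
    (s.setReg x v).Fits B := by
  refine ⟨fun y => ?_, h.2⟩
  rw [reg_setReg]; split
  · exact hv
  · exact h.1 y

theorem Fits.setMem {B : ℕ} {s : Store} (h : s.Fits B) (a : ℕ) (p : ℤ) {v : ℤ}
    (hv : v.natAbs ≤ B) : (s.setMem a p v).Fits B := by
  refine ⟨h.1, fun b q => ?_⟩
  rw [mem_setMem]; split
  · exact hv
  · exact h.2 b q

/-- The store without its first `K` registers and its first `K` arrays. -/
def drop (K : ℕ) (s : Store) : Store :=
  ⟨fun x => s.reg (x + K), fun a => s.mem (a + K)⟩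

theorem Fits.drop {B : ℕ} {s : Store} (h : s.Fits B) (K : ℕ) : (s.drop K).Fits B :=
  ⟨fun _ => h.1 _, fun _ _ => h.2 _ _⟩

@[simp] theorem drop_reg (K : ℕ) (s : Store) (x : ℕ) : (s.drop K).reg x = s.reg (x + K) := rfl

@[simp] theorem drop_mem (K : ℕ) (s : Store) (a : ℕ) : (s.drop K).mem a = s.mem (a + K) := rfl

theorem drop_setReg (K : ℕ) (s : Store) (x : ℕ) (v : ℤ) :
    (s.setReg (x + K) v).drop K = (s.drop K).setReg x v := by
  simp only [drop, setReg, Store.mk.injEq, and_true]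
  funext y
  simp [Function.update_apply]

theorem drop_setMem (K : ℕ) (s : Store) (a : ℕ) (p v : ℤ) :
    (s.setMem (a + K) p v).drop K = (s.drop K).setMem a p v := by
  simp only [drop, setMem, Store.mk.injEq, true_and]
  funext b
  simp [Function.update_apply]

end Store

/-! ### Registers and arrays that a program writes -/

/-- The program `P` contains an instruction that writes to the register `x`. -/
@[simp] def Prog.WritesReg : Prog → ℕ → Prop
  | .skip, _ => False
  | .const x _, y => y = x
  | .arith _ x _ _, y => y = x
  | .load x _ _, y => y = x
  | .store _ _ _, _ => False
  | .seq p q, y => p.WritesReg y ∨ q.WritesReg y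
  | .branch _ p q, y => p.WritesReg y ∨ q.WritesReg y
  | .loop _ p, y => p.WritesReg y

/-- The program `P` contains an instruction that writes to the array `a`. -/
@[simp] def Prog.WritesMem : Prog → ℕ → Prop
  | .skip, _ => False
  | .const _ _, _ => False
  | .arith _ _ _ _, _ => False
  | .load _ _ _, _ => False
  | .store a _ _, b => b = a
  | .seq p q, b => p.WritesMem b ∨ q.WritesMem b
  | .branch _ p q, b => p.WritesMem b ∨ q.WritesMem b
  | .loop _ p, b => p.WritesMem b

theorem Exec.reg_eq {B : ℕ} {P : Prog} {s s' : Store} {t : ℕ} (h : Exec B P s t s') {x : ℕ}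
    (hx : ¬ P.WritesReg x) : s'.reg x = s.reg x := by
  induction h <;> simp_all

theorem Exec.mem_eq {B : ℕ} {P : Prog} {s s' : Store} {t : ℕ} (h : Exec B P s t s') {a : ℕ}
    (ha : ¬ P.WritesMem a) : s'.mem a = s.mem a := by
  induction h with
  | store s b y x => exact Store.mem_setMem_of_ne _ ha _ _
  | _ => simp_all

theorem Exec.fits {B : ℕ} {P : Prog} {s s' : Store} {t : ℕ} (h : Exec B P s t s')
    (hs : s.Fits B) : s'.Fits B := by
  induction h with
  | const s x c h => exact hs.setReg x h
  | arith s o x y z h => exact hs.setReg x h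
  | load s x a y => exact hs.setReg x (hs.2 _ _)
  | store s a y x => exact hs.setMem a _ (hs.1 _)
  | _ => simp_all

/-- In `t` steps at most `t` cells change. -/
theorem Exec.exists_changed {B : ℕ} {P : Prog} {s s' : Store} {t : ℕ} (h : Exec B P s t s') :
    ∃ W : Finset (ℕ × ℤ), W.card ≤ t ∧ ∀ a p, (a, p) ∉ W → s'.mem a p = s.mem a p := by
  classical
  induction h with
  | store s a y x =>
    refine ⟨{(a, s.reg y)}, by simp, fun b p hb => ?_⟩
    rw [Store.mem_setMem, if_neg]
    rintro ⟨rfl, rfl⟩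
    simp at hb
  | seq hp hq ihp ihq =>
    obtain ⟨W, hW, h⟩ := ihp
    obtain ⟨W', hW', h'⟩ := ihq
    refine ⟨W ∪ W', (Finset.card_union_le _ _).trans (by omega), fun b p hb => ?_⟩
    rw [Finset.mem_union, not_or] at hb
    rw [h' b p hb.2, h b p hb.1]
  | loop_step hx hp hl ihp ihq =>
    obtain ⟨W, hW, h⟩ := ihp
    obtain ⟨W', hW', h'⟩ := ihq
    refine ⟨W ∪ W', (Finset.card_union_le _ _).trans (by omega), fun b p hb => ?_⟩
    rw [Finset.mem_union, not_or] at hb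
    rw [h' b p hb.2, h b p hb.1]
  | branch_pos hx hp ih =>
    obtain ⟨W, hW, h⟩ := ih
    exact ⟨W, by omega, h⟩
  | branch_neg hx hp ih =>
    obtain ⟨W, hW, h⟩ := ih
    exact ⟨W, by omega, h⟩
  | _ => exact ⟨∅, by simp, fun _ _ _ => by simp⟩

/-! ### Subroutines -/

/-- The program `P` with all its registers and arrays renamed by adding `K`. -/
def Prog.shift (K : ℕ) : Prog → Prog
  | .skip => .skip
  | .const x c => .const (x + K) c
  | .arith o x y z => .arith o (x + K) (y + K) (z + K)
  | .load x a y => .load (x + K) (a + K) (y + K)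
  | .store a y x => .store (a + K) (y + K) (x + K)
  | .seq p q => .seq (p.shift K) (q.shift K)
  | .branch x p q => .branch (x + K) (p.shift K) (q.shift K)
  | .loop x p => .loop (x + K) (p.shift K)

theorem Prog.not_writesReg_shift (P : Prog) {K x : ℕ} (hx : x < K) :
    ¬ (P.shift K).WritesReg x := by
  induction P <;> simp_all [Prog.shift] <;> omega

theorem Prog.not_writesMem_shift (P : Prog) {K a : ℕ} (ha : a < K) :
    ¬ (P.shift K).WritesMem a := by
  induction P <;> simp_all [Prog.shift]; omega

/-- The renamed program reads and writes only what `drop K` keeps, so a run on the dropped store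
lifts step by step with the same running time. -/
theorem Exec.shift {B : ℕ} {P : Prog} {u u' : Store} {t : ℕ} (h : Exec B P u t u') (K : ℕ)
    (s : Store) (hs : s.drop K = u) : ∃ s', Exec B (P.shift K) s t s' ∧ s'.drop K = u' := by
  induction h generalizing s with
  | skip _ => exact ⟨s, .skip s, hs⟩
  | const _ x c h => exact ⟨_, .const s _ c h, by rw [Store.drop_setReg, hs]⟩
  | arith _ o x y z h =>
    subst hs
    exact ⟨_, .arith s o _ _ _ h, Store.drop_setReg _ _ _ _⟩
  | load _ x a y =>
    subst hs
    exact ⟨_, .load s _ _ _, Store.drop_setReg _ _ _ _⟩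
  | store _ a y x =>
    subst hs
    exact ⟨_, .store s _ _ _, Store.drop_setMem _ _ _ _ _⟩
  | seq _ _ ihp ihq =>
    obtain ⟨s₁, h₁, e₁⟩ := ihp s hs
    obtain ⟨s₂, h₂, e₂⟩ := ihq s₁ e₁
    exact ⟨s₂, .seq h₁ h₂, e₂⟩
  | branch_pos hx _ ih =>
    obtain ⟨s₁, h₁, e₁⟩ := ih s hs
    subst hs
    exact ⟨s₁, .branch_pos hx h₁, e₁⟩
  | branch_neg hx _ ih =>
    obtain ⟨s₁, h₁, e₁⟩ := ih s hs
    subst hs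
    exact ⟨s₁, .branch_neg hx h₁, e₁⟩
  | loop_done hx =>
    subst hs
    exact ⟨s, .loop_done hx, rfl⟩
  | loop_step hx _ _ ihp ihq =>
    obtain ⟨s₁, h₁, e₁⟩ := ihp s hs
    obtain ⟨s₂, h₂, e₂⟩ := ihq s₁ e₁
    subst hs
    exact ⟨s₂, .loop_step hx h₁ h₂, e₂⟩

/-! ### Total correctness -/

/-- Started in `s`, the program `P` halts, and the number of steps and the final store satisfy
`Q`. -/
def Runs (B : ℕ) (P : Prog) (s : Store) (Q : ℕ → Store → Prop) : Prop :=
  ∃ t s', Exec B P s t s' ∧ Q t s'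

section Runs

variable {B : ℕ} {P : Prog} {s : Store} {Q R : ℕ → Store → Prop}

theorem Runs.mono (h : Runs B P s R) (hQ : ∀ t s', R t s' → Q t s') : Runs B P s Q :=
  let ⟨t, s', he, hR⟩ := h
  ⟨t, s', he, hQ t s' hR⟩

/-- A run comes with its frame: what the program does not write is unchanged. -/
theorem Runs.frame (h : Runs B P s R) (hs : s.Fits B) :
    Runs B P s fun t s' => R t s' ∧ s'.Fits B ∧ (∀ x, ¬ P.WritesReg x → s'.reg x = s.reg x) ∧
      ∀ a, ¬ P.WritesMem a → s'.mem a = s.mem a :=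
  let ⟨t, s', he, hR⟩ := h
  ⟨t, s', he, hR, he.fits hs, fun _ hx => he.reg_eq hx, fun _ ha => he.mem_eq ha⟩

-- The rules from here on are equivalences, so that rewriting executes straight-line code and leaves
-- the word-size conditions as conjuncts.
@[simp] theorem runs_skip : Runs B .skip s Q ↔ Q 1 s :=
  ⟨fun ⟨_, _, he, hQ⟩ => by cases he; exact hQ, fun h => ⟨_, _, .skip s, h⟩⟩

@[simp] theorem runs_const {x : ℕ} {c : ℤ} :
    Runs B (.const x c) s Q ↔ |c| ≤ B ∧ Q 1 (s.setReg x c) := by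
  rw [Int.abs_eq_natAbs, Nat.cast_le]
  exact ⟨fun ⟨_, _, he, hQ⟩ => by cases he; exact ⟨by assumption, hQ⟩,
    fun h => ⟨_, _, .const s x c h.1, h.2⟩⟩

theorem runs_arith {o : Op} {x y z : ℕ} :
    Runs B (.arith o x y z) s Q ↔
      |o.eval (s.reg y) (s.reg z)| ≤ B ∧ Q 1 (s.setReg x (o.eval (s.reg y) (s.reg z))) := by
  rw [Int.abs_eq_natAbs, Nat.cast_le]
  exact ⟨fun ⟨_, _, he, hQ⟩ => by cases he; exact ⟨by assumption, hQ⟩,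
    fun h => ⟨_, _, .arith s o x y z h.1, h.2⟩⟩

@[simp] theorem runs_load {x a y : ℕ} :
    Runs B (.load x a y) s Q ↔ Q 1 (s.setReg x (s.mem a (s.reg y))) :=
  ⟨fun ⟨_, _, he, hQ⟩ => by cases he; exact hQ, fun h => ⟨_, _, .load s x a y, h⟩⟩

@[simp] theorem runs_store {a y x : ℕ} :
    Runs B (.store a y x) s Q ↔ Q 1 (s.setMem a (s.reg y) (s.reg x)) :=
  ⟨fun ⟨_, _, he, hQ⟩ => by cases he; exact hQ, fun h => ⟨_, _, .store s a y x, h⟩⟩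

@[simp] theorem runs_seq {p q : Prog} :
    Runs B (.seq p q) s Q ↔ Runs B p s fun t s' => Runs B q s' fun t' => Q (t + t') := by
  constructor
  · rintro ⟨_, _, he, hQ⟩
    cases he with
    | seq hp hq => exact ⟨_, _, hp, _, _, hq, hQ⟩
  · rintro ⟨t, s', hp, t', s'', hq, hQ⟩
    exact ⟨_, _, .seq hp hq, hQ⟩

@[simp] theorem runs_branch {x : ℕ} {p q : Prog} :
    Runs B (.branch x p q) s Q ↔
      if 0 < s.reg x then Runs B p s fun t => Q (t + 1) else Runs B q s fun t => Q (t + 1) := by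
  constructor
  · rintro ⟨_, _, he, hQ⟩
    cases he with
    | branch_pos hx hp => rw [if_pos hx]; exact ⟨_, _, hp, hQ⟩
    | branch_neg hx hp => rw [if_neg hx.not_gt]; exact ⟨_, _, hp, hQ⟩
  · split
    · rintro ⟨t, s', hp, hQ⟩; exact ⟨_, _, .branch_pos ‹_› hp, hQ⟩
    · rintro ⟨t, s', hp, hQ⟩; exact ⟨_, _, .branch_neg (not_lt.1 ‹_›) hp, hQ⟩

/-- Calling a subroutine that works on the registers and arrays from `K` on. -/
theorem Runs.call {K : ℕ} (hs : s.Fits B) (h : Runs B P (s.drop K) R) :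
    Runs B (P.shift K) s fun t s' => R t (s'.drop K) ∧ s'.Fits B ∧
      (∀ x, x < K → s'.reg x = s.reg x) ∧ ∀ a, a < K → s'.mem a = s.mem a := by
  obtain ⟨t, u, he, hR⟩ := h
  obtain ⟨s', he', rfl⟩ := he.shift K s rfl
  exact ⟨t, s', he', hR, he'.fits hs, fun x hx => he'.reg_eq (P.not_writesReg_shift hx),
    fun a ha => he'.mem_eq (P.not_writesMem_shift ha)⟩

end Runs

/-- Run the programs of a list one after the other. -/
def block : List Prog → Prog
  | [] => .skip
  | p :: l => .seq p (block l)

section block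

variable {B : ℕ} {s : Store} {Q : ℕ → Store → Prop} {p : Prog} {l : List Prog}

@[simp] theorem runs_block_nil : Runs B (block []) s Q ↔ Q 1 s := runs_skip

@[simp] theorem runs_block_cons : Runs B (block (p :: l)) s Q ↔
    Runs B p s fun t s' => Runs B (block l) s' fun t' => Q (t + t') := runs_seq

@[simp] theorem writesReg_block_nil {x : ℕ} : ¬ (block []).WritesReg x := id

@[simp] theorem writesReg_block_cons {x : ℕ} :
    (block (p :: l)).WritesReg x ↔ p.WritesReg x ∨ (block l).WritesReg x := Iff.rfl

@[simp] theorem writesMem_block_nil {a : ℕ} : ¬ (block []).WritesMem a := id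

@[simp] theorem writesMem_block_cons {a : ℕ} :
    (block (p :: l)).WritesMem a ↔ p.WritesMem a ∨ (block l).WritesMem a := Iff.rfl

end block

/-! ### Loops with a counter -/

/-- Count the register `c` down to zero and run `body` for each of its values below the start
value; the register `1` has to hold `1`. -/
def countdown (c : ℕ) (body : Prog) : Prog :=
  .loop c (.seq (.arith .sub c c 1) body)

@[simp] theorem writesReg_countdown {c x : ℕ} {body : Prog} :
    (countdown c body).WritesReg x ↔ x = c ∨ body.WritesReg x := Iff.rfl

@[simp] theorem writesMem_countdown {c a : ℕ} {body : Prog} :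
    (countdown c body).WritesMem a ↔ body.WritesMem a := by
  simp [countdown]

/-- Each round pays `2` for the test and the decrement, and the last test adds `1`. The step
hypothesis supplies the frame relative to the initial store, so invariants need to mention only data
that change. -/
theorem runs_countdown {B c N τ : ℕ} {body : Prog} {s : Store} (Inv : ℕ → Store → Prop)
    (hc : c ≠ 1) (hbc : ¬ body.WritesReg c) (hb1 : ¬ body.WritesReg 1)
    (hs : s.Fits B) (h1 : s.reg 1 = 1) (hN : s.reg c = N) (h0 : Inv N s)
    (step : ∀ m < N, ∀ s₁ : Store, s₁.Fits B →
      (∀ x, x ≠ c → ¬ body.WritesReg x → s₁.reg x = s.reg x) →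
      (∀ a, ¬ body.WritesMem a → s₁.mem a = s.mem a) → Inv (m + 1) s₁ →
      Runs B body (s₁.setReg c m) fun t s₂ => t ≤ τ ∧ Inv m s₂) :
    Runs B (countdown c body) s fun t s' => t ≤ N * (τ + 2) + 1 ∧ Inv 0 s' ∧ s'.Fits B ∧
      (∀ x, x ≠ c → ¬ body.WritesReg x → s'.reg x = s.reg x) ∧
      ∀ a, ¬ body.WritesMem a → s'.mem a = s.mem a := by
  have key : ∀ m ≤ N, ∀ s₁ : Store, s₁.Fits B →
      (∀ x, x ≠ c → ¬ body.WritesReg x → s₁.reg x = s.reg x) →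
      (∀ a, ¬ body.WritesMem a → s₁.mem a = s.mem a) → s₁.reg c = m → Inv m s₁ →
      Runs B (countdown c body) s₁ fun t s' => t ≤ m * (τ + 2) + 1 ∧ Inv 0 s' := by
    intro m
    induction m with
    | zero =>
      intro _ s₁ _ _ _ hm hI
      exact ⟨1, s₁, .loop_done hm.le, by simp, hI⟩
    | succ m ih =>
      intro hm s₁ hf hr hme hcm hI
      have hf' : (s₁.setReg c m).Fits B := hf.setReg c (by have := hf.1 c; omega)
      obtain ⟨t, s₂, he, ⟨ht, hI₂⟩, hf₂, hr₂, hm₂⟩ := (step m hm s₁ hf hr hme hI).frame hf'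
      obtain ⟨t', s₃, he', ht', hI₃⟩ := ih (by omega) s₂ hf₂
        (fun x hx hb => by rw [hr₂ x hb, Store.reg_setReg, if_neg hx, hr x hx hb])
        (fun a ha => by rw [hm₂ a ha, Store.mem_setReg, hme a ha])
        (by rw [hr₂ c hbc]; simp) hI₂
      have e : Op.sub.eval (s₁.reg c) (s₁.reg 1) = m := by
        rw [hcm, hr 1 hc.symm hb1, h1]; simp [Op.eval]
      have hd : Exec B (.arith .sub c c 1) s₁ 1 (s₁.setReg c m) := by
        have := Exec.arith (B := B) s₁ .sub c c 1 (by rw [e]; have := hf.1 c; omega)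
        rwa [e] at this
      refine ⟨_, s₃, .loop_step (by omega) (.seq hd he) he', ?_, hI₃⟩
      have : (m + 1) * (τ + 2) = m * (τ + 2) + (τ + 2) := by ring
      omega
  refine ((key N le_rfl s hs (fun _ _ _ => rfl) (fun _ _ => rfl) hN h0).frame hs).mono ?_
  rintro t s' ⟨⟨ht, hI⟩, hf, hr, hm⟩
  exact ⟨ht, hI, hf, fun x hx hb => hr x (by simp [hx, hb]), fun a ha => hm a (by simpa using ha)⟩

/-- For every value of the counter `c`, write the value that `body` leaves in the register `v` to
the cell `c` of the array `a`. -/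
def fill (c a v : ℕ) (body : Prog) : Prog :=
  countdown c (.seq body (.store a c v))

@[simp] theorem writesReg_fill {c a v x : ℕ} {body : Prog} :
    (fill c a v body).WritesReg x ↔ x = c ∨ body.WritesReg x := by
  simp [fill]

@[simp] theorem writesMem_fill {c a v b : ℕ} {body : Prog} :
    (fill c a v body).WritesMem b ↔ body.WritesMem b ∨ b = a := by
  simp [fill]

/-- Cells are written from the top down, so the cell about to be written still holds its old value.
The body may read it, which allows updating an array in place. -/
theorem runs_fill {B c a v N τ : ℕ} {body : Prog} {s : Store} (f : ℕ → ℤ)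
    (hc : c ≠ 1) (hbc : ¬ body.WritesReg c) (hb1 : ¬ body.WritesReg 1)
    (hbm : ∀ b, ¬ body.WritesMem b)
    (hs : s.Fits B) (h1 : s.reg 1 = 1) (hN : s.reg c = N)
    (step : ∀ m < N, ∀ s₁ : Store, s₁.Fits B →
      (∀ x, x ≠ c → ¬ body.WritesReg x → s₁.reg x = s.reg x) →
      (∀ b, b ≠ a → s₁.mem b = s.mem b) → s₁.reg c = m → s₁.mem a m = s.mem a m →
      Runs B body s₁ fun t s₂ => t ≤ τ ∧ s₂.reg v = f m) :
    Runs B (fill c a v body) s fun t s' => t ≤ N * (τ + 3) + 1 ∧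
      (∀ p : ℕ, p < N → s'.mem a p = f p) ∧ s'.Fits B ∧
      (∀ x, x ≠ c → ¬ body.WritesReg x → s'.reg x = s.reg x) ∧
      ∀ b, b ≠ a → s'.mem b = s.mem b := by
  refine (runs_countdown (τ := τ + 1)
    (fun m s' => (∀ p : ℕ, p < m → s'.mem a p = s.mem a p) ∧
      ∀ p : ℕ, m ≤ p → p < N → s'.mem a p = f p) hc (by simpa using hbc) (by simpa using hb1)
    hs h1 hN ⟨fun _ _ => rfl, fun p h h' => absurd h' h.not_gt⟩ ?_).mono ?_
  · intro m hm s₁ hf hr hme ⟨hI, hI'⟩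
    have hf' : (s₁.setReg c m).Fits B := hf.setReg c (by have := hs.1 c; omega)
    rw [runs_seq]
    refine ((step m hm (s₁.setReg c m) hf' (fun x hx hb => ?_) (fun b hb => ?_) (by simp)
      (hI m (by omega))).frame hf').mono ?_
    · rw [Store.reg_setReg, if_neg hx, hr x hx (by simpa using hb)]
    · exact hme b (by simp [hbm, hb])
    · rintro t s₂ ⟨⟨ht, hv⟩, -, hr₂, hm₂⟩
      rw [runs_store, hr₂ c hbc, Store.reg_setReg, if_pos rfl, hv]
      have ha := hm₂ a (hbm a)
      refine ⟨by omega, fun p hp => ?_, fun p hp hpN => ?_⟩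
      · rw [Store.mem_setMem, if_neg (by omega), ha]
        exact hI p (by omega)
      · rw [Store.mem_setMem]
        split
        · next h => congr 1; omega
        · next h =>
          rw [ha]
          exact hI' p (by simp only [true_and] at h; omega) hpN
  · rintro t s' ⟨ht, ⟨-, hI⟩, hf, hr, hm⟩
    exact ⟨by simpa [add_assoc] using ht, fun p hp => hI p (Nat.zero_le _) hp, hf,
      fun x hx hb => hr x hx (by simpa using hb), fun b hb => hm b (by simp [hbm, hb])⟩

end WordRAM

/-! ### Cubic matrix multiplication and the quadratic lower bound. -/

namespace WordRAM

/-- The machine has no remainder instruction; programs compute `m % n` in this way. -/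
theorem natCast_sub_div_mul (m n : ℕ) :
    (m : ℤ) - ((m / n : ℕ) : ℤ) * n = ((m % n : ℕ) : ℤ) := by
  rw [Int.natCast_emod, Int.natCast_ediv, Int.emod_def]; ring

theorem div_mul_add_lt {p n k : ℕ} (hp : p < n * n) (hk : k < n) : p / n * n + k < n * n := by
  have : p / n < n := Nat.div_lt_of_lt_mul hp
  nlinarith

theorem mul_add_mod_lt {n k : ℕ} (p : ℕ) (hk : k < n) : k * n + p % n < n * n := by
  have : p % n < n := Nat.mod_lt _ (by omega)
  nlinarith

theorem abs_natCast_le {p B : ℕ} (h : p ≤ B) : |(p : ℤ)| ≤ B := by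
  rw [Nat.abs_cast]; exact_mod_cast h

theorem abs_sum_Ico_le {m n : ℕ} {g : ℕ → ℤ} {b : ℤ} (hb : 0 ≤ b) (hg : ∀ k < n, |g k| ≤ b) :
    |∑ k ∈ Finset.Ico m n, g k| ≤ n * b := by
  refine (Finset.abs_sum_le_sum_abs _ _).trans ((Finset.sum_le_card_nsmul _ _ b fun k hk =>
    hg k (Finset.mem_Ico.1 hk).2).trans ?_)
  rw [Nat.card_Ico, nsmul_eq_mul]
  gcongr
  omega

/-- Matrix multiplication by the definition. -/
def naiveMatMul : Prog :=
  block [.const 1 1, .const 2 0, .arith .mul 3 0 0, .arith .add 4 3 2,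
    -- For the output cell in register `4`, register `7` is the start of its row and register `8`
    -- its column; register `9` counts the summation index down.
    fill 4 2 5 (block [.arith .div 6 4 0, .arith .mul 7 6 0, .arith .sub 8 4 7, .const 5 0,
      .arith .add 9 0 2,
      countdown 9 (block [.arith .add 10 7 9, .load 10 0 10, .arith .mul 11 9 0,
        .arith .add 11 11 8, .load 11 1 11, .arith .mul 10 10 11, .arith .add 5 5 10])])]

theorem naiveMatMul_spec {B n b : ℕ} (hB : n * n * (b * b + 1) + 1 ≤ B) {s : Store}
    (hn : 1 ≤ n) (hs : s.Fits B) (h0 : s.reg 0 = n)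
    (hX : ∀ p < n * n, |s.mem 0 p| ≤ b) (hY : ∀ p < n * n, |s.mem 1 p| ≤ b) :
    Runs B naiveMatMul s fun t s' => t ≤ 50 * n ^ 3 ∧ ∀ p < n * n, s'.mem 2 p =
      ∑ k ∈ Finset.range n,
        s.mem 0 ((p / n * n + k : ℕ) : ℤ) * s.mem 1 ((k * n + p % n : ℕ) : ℤ) := by
  have hnn : n ≤ n * n := by nlinarith
  have hn1 : n * n + 1 ≤ B := by nlinarith [Nat.zero_le (n * n * (b * b))]
  have hn2 : n * (b * b) ≤ B := by nlinarith [Nat.zero_le (b * b)]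
  have hn3 : b * b ≤ B := by nlinarith [Nat.zero_le (b * b)]
  have c1 : |(1 : ℤ)| ≤ B := abs_natCast_le (p := 1) (by omega)
  have c0 : |(0 : ℤ)| ≤ B := abs_natCast_le (p := 0) (by omega)
  simp only [naiveMatMul, runs_block_cons, runs_block_nil, runs_const, runs_arith, Op.eval,
    Store.reg_setReg_beq, Nat.reduceBEq, cond_true, cond_false, h0, add_zero, ← Nat.cast_mul]
  refine ⟨c1, c0, abs_natCast_le (by omega), abs_natCast_le (by omega), ?_⟩
  refine (runs_fill (N := n * n) (τ := n * 10 + 10) (fun p => ∑ k ∈ Finset.range n,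
      s.mem 0 ((p / n * n + k : ℕ) : ℤ) * s.mem 1 ((k * n + p % n : ℕ) : ℤ))
    (by decide) (by simp) (by simp) (by simp) ?_ (by simp) (by simp) ?_).mono ?_
  · refine (((hs.setReg _ ?_).setReg _ ?_).setReg _ ?_).setReg _ ?_ <;> simp <;> omega
  · intro m hm s₁ hf hr hme h4 _
    have r0 : s₁.reg 0 = n := by simpa [h0] using hr 0 (by decide) (by simp)
    have r1 : s₁.reg 1 = 1 := by simpa using hr 1 (by decide) (by simp)
    have r2 : s₁.reg 2 = 0 := by simpa using hr 2 (by decide) (by simp)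
    have m0 : s₁.mem 0 = s.mem 0 := hme 0 (by decide)
    have m1 : s₁.mem 1 = s.mem 1 := hme 1 (by decide)
    have hdm : m / n * n ≤ m := Nat.div_mul_le_self m n
    have hd : m / n ≤ m := Nat.div_le_self m n
    have hmod : m % n ≤ m := Nat.mod_le m n
    simp only [runs_block_cons, runs_block_nil, runs_const, runs_arith, Op.eval,
      Store.reg_setReg_beq, Nat.reduceBEq, cond_true, cond_false, r0, r2, h4, add_zero,
      ← Int.natCast_ediv, natCast_sub_div_mul]
    simp only [← Nat.cast_mul]
    refine ⟨abs_natCast_le (by omega), abs_natCast_le (by omega), abs_natCast_le (by omega),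
      c0, abs_natCast_le (by omega), ?_⟩
    set g : ℕ → ℤ := fun k =>
      s.mem 0 ((m / n * n + k : ℕ) : ℤ) * s.mem 1 ((k * n + m % n : ℕ) : ℤ) with hg
    have hgb : ∀ k < n, |g k| ≤ ((b * b : ℕ) : ℤ) := fun k hk => by
      rw [hg, abs_mul, Nat.cast_mul]
      exact mul_le_mul (hX _ (div_mul_add_lt hm hk)) (hY _ (mul_add_mod_lt m hk)) (abs_nonneg _)
        (by positivity)
    -- The index counts down, so register `5` accumulates the sum from its upper end.
    refine (runs_countdown (N := n) (τ := 8)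
      (fun k s₂ => s₂.reg 5 = ∑ i ∈ Finset.Ico k n, g i)
      (by decide) (by simp) (by simp) ?_ (by simpa using r1) (by simp) (by simp) ?_).mono ?_
    · refine ((((hf.setReg _ ?_).setReg _ ?_).setReg _ ?_).setReg _ ?_).setReg _ ?_ <;>
        first | (rw [Int.natAbs_natCast]; omega) | simp
    · intro k hk s₂ _ hr₂ hm₂ h5
      have q0 : s₂.reg 0 = n := by simpa [r0] using hr₂ 0 (by decide) (by simp)
      have q7 : s₂.reg 7 = (m / n * n : ℕ) := by simpa using hr₂ 7 (by decide) (by simp)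
      have q8 : s₂.reg 8 = (m % n : ℕ) := by simpa using hr₂ 8 (by decide) (by simp)
      have k0 : s₂.mem 0 = s.mem 0 := (hm₂ 0 (by simp)).trans m0
      have k1 : s₂.mem 1 = s.mem 1 := (hm₂ 1 (by simp)).trans m1
      have b0 := div_mul_add_lt hm hk
      have b1 := mul_add_mod_lt m hk
      have hsum : g k + ∑ i ∈ Finset.Ico (k + 1) n, g i = ∑ i ∈ Finset.Ico k n, g i :=
        (Finset.sum_eq_sum_Ico_succ_bot hk g).symm
      simp only [runs_block_cons, runs_block_nil, runs_arith, runs_load, Op.eval,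
        Store.reg_setReg_beq, Store.mem_setReg, Nat.reduceBEq, cond_true, cond_false, q0, q7, q8,
        k0, k1, h5, ← Nat.cast_mul, ← Nat.cast_add]
      change _ ∧ _ ∧ _ ∧ |g k| ≤ _ ∧ |_ + g k| ≤ _ ∧ _ ∧ _ + g k = _
      rw [add_comm _ (g k), hsum]
      refine ⟨abs_natCast_le (by omega), abs_natCast_le (by omega), abs_natCast_le (by omega),
        (hgb k hk).trans (by exact_mod_cast hn3),
        (abs_sum_Ico_le (by positivity) hgb).trans (by exact_mod_cast hn2), by omega, rfl⟩
    · rintro t s₂ ⟨ht, h5, -⟩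
      exact ⟨by omega, by rw [h5, Finset.range_eq_Ico]⟩
  · rintro t s' ⟨ht, hf, -⟩
    refine ⟨?_, hf⟩
    have h1 : n * n ≤ n ^ 3 := by rw [pow_succ, sq]; nlinarith
    have h2 : n * n * (n * 10 + 10 + 3) = 10 * n ^ 3 + 13 * (n * n) := by ring
    have h3 : 1 ≤ n ^ 3 := Nat.one_le_pow _ _ hn
    omega

end WordRAM

open WordRAM

theorem exists_fin_mul_add {n p : ℕ} (hp : p < n * n) :
    ∃ i j : Fin n, p = (i : ℕ) * n + j :=
  ⟨⟨p / n, Nat.div_lt_of_lt_mul hp⟩, ⟨p % n, Nat.mod_lt _ (by by_contra h; simp_all)⟩,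
    (Nat.div_add_mod' p n).symm⟩

theorem fin_mul_add_lt {n : ℕ} (i j : Fin n) : (i : ℕ) * n + j < n * n := by
  have := i.2; have := j.2; nlinarith

theorem fin_mul_add_div {n : ℕ} (i j : Fin n) : ((i : ℕ) * n + j) / n = i := by
  have := j.2
  rw [Nat.mul_comm, Nat.mul_add_div (by omega), Nat.div_eq_of_lt j.2, add_zero]

theorem fin_mul_add_mod {n : ℕ} (i j : Fin n) : ((i : ℕ) * n + j) % n = j := by
  rw [Nat.mul_comm, Nat.mul_add_mod, Nat.mod_eq_of_lt j.2]

/-- Needed only to make the set whose infimum is `matMulExponent` nonempty. -/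
theorem matMulInSoftO_cube : MatMulInSoftO fun n => (n : ℝ) ^ (3 : ℝ) := by
  intro c
  refine ⟨naiveMatMul, 2 * c + 3, 0, 50, fun n hn X B hB s hs ⟨hX, h0, hm⟩ => ?_⟩
  have hb : n * n * (n ^ c * n ^ c + 1) + 1 ≤ B := by
    refine le_trans ?_ hB
    have h1 : n * n * (n ^ c * n ^ c + 1) + 1 ≤ (n + 2) * ((n + 1) ^ 2 * (n + 1) ^ (2 * c)) := by
      have h2 : n ^ c * n ^ c = n ^ (2 * c) := by ring
      have h3 : n ^ (2 * c) ≤ (n + 1) ^ (2 * c) := Nat.pow_le_pow_left (by omega) _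
      have h4 : 1 ≤ (n + 1) ^ (2 * c) := Nat.one_le_pow _ _ (by omega)
      have h5 : n * n ≤ (n + 1) ^ 2 := by nlinarith
      have h6 : 1 ≤ (n + 1) ^ 2 := Nat.one_le_pow _ _ (by omega)
      have h7 : n * n * (n ^ (2 * c) + 1) ≤ (n + 1) ^ 2 * (2 * (n + 1) ^ (2 * c)) :=
        Nat.mul_le_mul h5 (by omega)
      have h8 : 1 ≤ (n + 1) ^ 2 * (n + 1) ^ (2 * c) := Nat.one_le_iff_ne_zero.2 (by positivity)
      rw [h2]
      nlinarith
    refine h1.trans ?_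
    calc (n + 2) * ((n + 1) ^ 2 * (n + 1) ^ (2 * c))
        ≤ (n + 2) * ((n + 2) ^ 2 * (n + 2) ^ (2 * c)) := by gcongr <;> omega
      _ = (n + 2) ^ (2 * c + 3) := by ring
  have hX0 : ∀ p < n * n, |s.mem 0 p| ≤ (n ^ c : ℕ) := fun p hp => by
    obtain ⟨i, j, rfl⟩ := exists_fin_mul_add hp
    rw [(hm i j).1, Int.abs_eq_natAbs, Nat.cast_le]
    exact (hX i j).1
  have hX1 : ∀ p < n * n, |s.mem 1 p| ≤ (n ^ c : ℕ) := fun p hp => by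
    obtain ⟨i, j, rfl⟩ := exists_fin_mul_add hp
    rw [(hm i j).2, Int.abs_eq_natAbs, Nat.cast_le]
    exact (hX i j).2
  obtain ⟨t, s', he, ht, hout⟩ := naiveMatMul_spec hb hn hs h0 hX0 hX1
  refine ⟨t, s', he, fun i j => ?_, ?_⟩
  · rw [hout _ (fin_mul_add_lt i j), Matrix.mul_apply, Finset.sum_range]
    refine Finset.sum_congr rfl fun k _ => ?_
    rw [fin_mul_add_div, fin_mul_add_mod, (hm i k).1, (hm k j).2]
  · rw [pow_zero, mul_one]
    have : (t : ℝ) ≤ ((50 * n ^ 3 : ℕ) : ℝ) := by exact_mod_cast ht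
    simp only [Real.rpow_ofNat]
    simpa using this

/-- Writing down a product of two `n × n` matrices takes at least `n ^ 2` steps. -/
theorem sq_le_of_matMul {c n B : ℕ} {P : Prog} {τ : ℝ}
    (hB : n + 2 ≤ B)
    (hP : ∀ X, ∀ s : Store, s.Fits B → MatMulInput c n X s →
      ∃ (t : ℕ) (s' : Store), Exec B P s t s' ∧ MatMulOutput n X s' ∧ (t : ℝ) ≤ τ) :
    (n : ℝ) ^ 2 ≤ τ := by
  classical
  -- The product of zero matrices is zero. With array `2` initially filled with `1`, each of the `n
  -- * n` output cells has to change, and one step changes at most one cell.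
  obtain ⟨t, s', he, hout, ht⟩ := hP (0, 0)
    ⟨fun x => if x = 0 then n else 0, fun a _ => if a = 2 then 1 else 0⟩
    ⟨fun x => by dsimp only; split <;> simp; omega, fun a p => by dsimp only; split <;> simp; omega⟩
    ⟨by simp, by simp, by simp⟩
  refine le_trans ?_ ht
  obtain ⟨W, hW, h⟩ := he.exists_changed
  have key : (Finset.range (n * n)).card ≤ W.card := by
    refine Finset.card_le_card_of_injOn (fun p => ((2 : ℕ), (p : ℤ))) (fun p hp => ?_) ?_
    · by_contra hpW
      obtain ⟨i, j, rfl⟩ := exists_fin_mul_add (Finset.mem_range.1 hp)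
      have h1 := h 2 _ hpW
      rw [hout i j] at h1
      simp at h1
    · intro p _ q _ hpq
      simpa using hpq
  rw [Finset.card_range] at key
  rw [sq]
  exact_mod_cast key.trans hW

/-! ### Max-plus products of matrices with bounded entries. -/

open WordRAM

/-- The store holds `n` in register `0` and two `n × n` integer matrices, with entries of absolute
value at most `M`, row by row in the arrays `0` and `1`. -/
def MaxPlusInput (M n : ℕ) (X : Matrix (Fin n) (Fin n) ℤ × Matrix (Fin n) (Fin n) ℤ)
    (s : Store) : Prop :=
  (∀ i j, |X.1 i j| ≤ M ∧ |X.2 i j| ≤ M) ∧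
  s.reg 0 = n ∧
  ∀ i j : Fin n, s.mem 0 (((i : ℕ) * n + (j : ℕ) : ℕ) : ℤ) = X.1 i j ∧
    s.mem 1 (((i : ℕ) * n + (j : ℕ) : ℕ) : ℤ) = X.2 i j

/-- The array `2` holds the max-plus product of the two matrices, row by row. -/
def MaxPlusOutput (n : ℕ) (X : Matrix (Fin n) (Fin n) ℤ × Matrix (Fin n) (Fin n) ℤ)
    (s : Store) : Prop :=
  ∀ i j : Fin n, IsGreatest (Set.range fun k => X.1 i k + X.2 k j)
    (s.mem 2 (((i : ℕ) * n + (j : ℕ) : ℕ) : ℤ))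

namespace WordRAM

/-- Set register `5` to `1` or `0` according to whether the cell of the array `src` at the address
in register `4` holds the same word as the register `r`. -/
def indicator (src r : ℕ) : Prog :=
  -- Only positivity can be tested; equality is the failure of both strict inequalities.
  block [.load 6 src 4, .arith .sub 6 6 r, .branch 6 (.const 5 0)
    (block [.arith .sub 6 2 6, .branch 6 (.const 5 0) (.const 5 1)])]

theorem runs_fill_indicator {B M N src dst r : ℕ} {s : Store} (hB : 2 * M + 1 ≤ B)
    (hs : s.Fits B) (h1 : s.reg 1 = 1) (h2 : s.reg 2 = 0) (h4 : s.reg 4 = N) (hsd : src ≠ dst)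
    (hr : r ≠ 4 ∧ r ≠ 5 ∧ r ≠ 6) (hrM : |s.reg r| ≤ M) (hM : ∀ p < N, |s.mem src p| ≤ M) :
    Runs B (fill 4 dst 5 (indicator src r)) s fun t s' => t ≤ N * 13 + 1 ∧
      (∀ p : ℕ, p < N → s'.mem dst p = if s.mem src p = s.reg r then 1 else 0) ∧ s'.Fits B ∧
      (∀ x, x ≠ 4 → x ≠ 5 → x ≠ 6 → s'.reg x = s.reg x) ∧
      ∀ b, b ≠ dst → s'.mem b = s.mem b := by
  have c1 : |(1 : ℤ)| ≤ B := abs_natCast_le (p := 1) (by omega)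
  have c0 : |(0 : ℤ)| ≤ B := abs_natCast_le (p := 0) (by omega)
  refine (runs_fill (τ := 10) (fun p => if s.mem src p = s.reg r then 1 else 0)
    (by decide) (by simp [indicator]) (by simp [indicator]) (by simp [indicator]) hs h1 h4
    ?_).mono ?_
  · intro m hm s₁ hf hr₁ hm₁ q4 _
    have q2 : s₁.reg 2 = 0 := (hr₁ 2 (by decide) (by simp [indicator])).trans h2
    have qr : s₁.reg r = s.reg r := hr₁ r hr.1 (by simp [indicator, hr])
    have hle := abs_le.1 (hM m hm)
    have hle' := abs_le.1 hrM
    have hb : |s.mem src m - s.reg r| ≤ B := abs_le.2 ⟨by omega, by omega⟩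
    have hb' : |-(s.mem src m - s.reg r)| ≤ B := by rwa [abs_neg]
    have e6 : (r == 6) = false := beq_false_of_ne hr.2.2
    simp only [indicator, runs_block_cons, runs_block_nil, runs_const, runs_arith, runs_load,
      runs_branch, Op.eval, Store.reg_setReg_beq, Store.mem_setReg, Nat.reduceBEq, cond_true,
      cond_false, q2, q4, qr, e6, hm₁ src hsd, zero_sub]
    refine ⟨hb, ?_⟩
    split
    · exact ⟨c0, by omega, by rw [if_neg (by omega)]⟩
    · refine ⟨hb', ?_⟩
      split
      · exact ⟨c0, by omega, by rw [if_neg (by omega)]⟩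
      · exact ⟨c1, by omega, by rw [if_pos (by omega)]⟩
  · rintro t s' ⟨ht, hd, hf, hr', hm'⟩
    exact ⟨ht, hd, hf, fun x h4 h5 h6 => hr' x h4 (by simp [indicator, h5, h6]), hm'⟩

/-- If some entries with the values coded by register `8` meet, raise the entries of the array `2`
to their sum. -/
def maxPlusRound (P : Prog) : Prog :=
  -- Register `8` holds the code `(a + M) * (2 * M + 1) + (b + M)`; registers `12`, `13`, `14`
  -- receive `a`, `b`, `a + b`.
  block [.arith .div 6 8 10, .arith .mul 7 6 10, .arith .sub 7 8 7,
    .arith .sub 12 6 11, .arith .sub 13 7 11, .arith .add 14 12 13,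
    .arith .add 4 3 2, fill 4 16 5 (indicator 0 12),
    .arith .add 4 3 2, fill 4 17 5 (indicator 1 13),
    .arith .add 16 0 2, P.shift 16,
    -- Array `18` is array `2` of the subroutine, that is, the product of the indicator matrices.
    .arith .add 4 3 2, fill 4 2 5 (block [.load 6 18 4, .load 5 2 4,
      .branch 6 (block [.arith .sub 7 14 5, .branch 7 (.arith .add 5 14 2) .skip]) .skip])]

/-- The max-plus product of matrices with entries of absolute value at most `M`, by multiplications
of `0`-`1` matrices with the program `P`. -/
def maxPlus (M : ℕ) (P : Prog) : Prog :=
  block [.const 1 1, .const 2 0, .arith .mul 3 0 0, .const 10 (2 * M + 1 : ℕ), .const 11 M,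
    .const 5 (-(2 * M)), .arith .add 4 3 2, fill 4 2 5 .skip, .const 8 ((2 * M + 1) ^ 2 : ℕ),
    countdown 8 (maxPlusRound P)]

variable {B M n τ : ℕ} {P : Prog} {X : Matrix (Fin n) (Fin n) ℤ × Matrix (Fin n) (Fin n) ℤ}

/-- The entry of the product counts the witnesses `k`. -/
theorem indicator_mul_indicator_pos {X : Matrix (Fin n) (Fin n) ℤ × Matrix (Fin n) (Fin n) ℤ}
    {a b : ℤ} (i j : Fin n) :
    0 < (Matrix.of (fun i k => if X.1 i k = a then (1 : ℤ) else 0) *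
      Matrix.of fun k j => if X.2 k j = b then (1 : ℤ) else 0) i j ↔
      ∃ k, X.1 i k = a ∧ X.2 k j = b := by
  rw [Matrix.mul_apply, Finset.sum_pos_iff_of_nonneg]
  · simp only [Matrix.of_apply, Finset.mem_univ, true_and]
    refine exists_congr fun k => ?_
    split <;> split <;> simp_all
  · intro k _
    simp only [Matrix.of_apply]
    split <;> split <;> simp

set_option maxHeartbeats 1000000 in
-- Indicator entries are at most `1 = n ^ 0`, hence `MatMulInput 0`. The bound `hF` on the running
-- maxima keeps their differences from `a + b` within `4 * M`.
theorem runs_maxPlusRound (hB : 4 * M + 1 ≤ B) (hnB : n * n + 1 ≤ B)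
    (hP : ∀ X, ∀ s : Store, s.Fits B → MatMulInput 0 n X s →
      Runs B P s fun t s' => t ≤ τ ∧ MatMulOutput n X s')
    {s : Store} (hs : s.Fits B) (hn : 1 ≤ n) (hX : MaxPlusInput M n X s) (h1 : s.reg 1 = 1)
    (h2 : s.reg 2 = 0) (h3 : s.reg 3 = (n * n : ℕ)) (h10 : s.reg 10 = (2 * M + 1 : ℕ))
    (h11 : s.reg 11 = M)
    {q : ℕ} (h8 : s.reg 8 = q) (hq : q < (2 * M + 1) * (2 * M + 1))
    {a b : ℤ} (ha : a = (q / (2 * M + 1) : ℕ) - M) (hb : b = (q % (2 * M + 1) : ℕ) - M)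
    (hF : ∀ p < n * n, |s.mem 2 p| ≤ 2 * M) :
    Runs B (maxPlusRound P) s fun t s' => t ≤ τ + n * n * 40 + 40 ∧
      ∀ i j : Fin n, s'.mem 2 ((i * n + j : ℕ) : ℤ) =
        if (∃ k, X.1 i k = a ∧ X.2 k j = b) ∧ s.mem 2 ((i * n + j : ℕ) : ℤ) < a + b then a + b
        else s.mem 2 ((i * n + j : ℕ) : ℤ) := by
  obtain ⟨hXM, h0, hXm⟩ := hX
  have hd : q / (2 * M + 1) < 2 * M + 1 := Nat.div_lt_of_lt_mul hq
  have hmod : q % (2 * M + 1) < 2 * M + 1 := Nat.mod_lt _ (by omega)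
  have hqB := hs.1 8
  rw [h8, Int.natAbs_natCast] at hqB
  have hdm : q / (2 * M + 1) * (2 * M + 1) ≤ q := Nat.div_mul_le_self q _
  have hnn : n ≤ n * n := by nlinarith
  have hM0 : ∀ p < n * n, |s.mem 0 p| ≤ M := fun p hp => by
    obtain ⟨i, j, rfl⟩ := exists_fin_mul_add hp
    rw [(hXm i j).1]; exact (hXM i j).1
  have hM1 : ∀ p < n * n, |s.mem 1 p| ≤ M := fun p hp => by
    obtain ⟨i, j, rfl⟩ := exists_fin_mul_add hp
    rw [(hXm i j).2]; exact (hXM i j).2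
  have hq0 := Int.natCast_nonneg (q / (2 * M + 1))
  have hq1 := Int.natCast_nonneg (q % (2 * M + 1))
  have haM : |a| ≤ M := abs_le.2 ⟨by omega, by omega⟩
  have hbM : |b| ≤ M := abs_le.2 ⟨by omega, by omega⟩
  have haM' := abs_le.1 haM
  have hbM' := abs_le.1 hbM
  simp only [maxPlusRound, runs_block_cons, runs_arith, Op.eval,
    Store.reg_setReg_beq, Store.mem_setReg, Nat.reduceBEq, cond_true, cond_false,
    h0, h1, h2, h3, h8, h10, h11, add_zero, ← Int.natCast_ediv, natCast_sub_div_mul]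
  rw [← ha, ← hb]
  simp only [← Nat.cast_mul]
  refine ⟨abs_natCast_le (by omega), abs_natCast_le (by omega), abs_natCast_le (by omega),
    abs_le.2 ⟨by omega, by omega⟩, abs_le.2 ⟨by omega, by omega⟩, abs_le.2 ⟨by omega, by omega⟩,
    abs_natCast_le (by omega), ?_⟩
  refine (runs_fill_indicator (M := M) (N := n * n) (by omega) ?_ ?_ ?_ ?_ (by decide) (by decide)
    ?_ ?_).mono ?_
  · refine ((((((hs.setReg _ ?_).setReg _ ?_).setReg _ ?_).setReg _ ?_).setReg _ ?_).setReg _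
      ?_).setReg _ ?_ <;> omega
  · simpa using h1
  · simpa using h2
  · simp
  · simpa using haM
  · exact hM0
  rintro t₁ s₁ ⟨ht₁, hd₁, hf₁, hr₁, hm₁⟩
  have q0 : s₁.reg 0 = n := by simpa [h0] using hr₁ 0 (by decide) (by decide) (by decide)
  have q1 : s₁.reg 1 = 1 := by simpa [h1] using hr₁ 1 (by decide) (by decide) (by decide)
  have q2 : s₁.reg 2 = 0 := by simpa [h2] using hr₁ 2 (by decide) (by decide) (by decide)
  have q3 : s₁.reg 3 = (n * n : ℕ) := by
    simpa [h3] using hr₁ 3 (by decide) (by decide) (by decide)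
  have q13 : s₁.reg 13 = b := by simpa using hr₁ 13 (by decide) (by decide) (by decide)
  have q14 : s₁.reg 14 = a + b := by simpa using hr₁ 14 (by decide) (by decide) (by decide)
  simp only [runs_block_cons, runs_arith, Op.eval, Store.reg_setReg_beq, q2, q3, add_zero]
  refine ⟨abs_natCast_le (by omega), ?_⟩
  refine (runs_fill_indicator (M := M) (N := n * n) (by omega) ?_ ?_ ?_ ?_ (by decide) (by decide)
    ?_ ?_).mono ?_
  · exact hf₁.setReg _ (by omega)
  · simpa using q1
  · simpa using q2
  · simp
  · simpa [q13] using hbM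
  · rw [Store.mem_setReg, hm₁ 1 (by decide)]; exact hM1
  rintro t₂ s₂ ⟨ht₂, hd₂, hf₂, hr₂, hm₂⟩
  have r0 : s₂.reg 0 = n := by simpa [q0] using hr₂ 0 (by decide) (by decide) (by decide)
  have r1 : s₂.reg 1 = 1 := by simpa [q1] using hr₂ 1 (by decide) (by decide) (by decide)
  have r2 : s₂.reg 2 = 0 := by simpa [q2] using hr₂ 2 (by decide) (by decide) (by decide)
  have r3 : s₂.reg 3 = (n * n : ℕ) := by
    simpa [q3] using hr₂ 3 (by decide) (by decide) (by decide)
  have r14 : s₂.reg 14 = a + b := by simpa [q14] using hr₂ 14 (by decide) (by decide) (by decide)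
  simp only [runs_block_cons, runs_arith, Op.eval, r0, r2, add_zero]
  refine ⟨abs_natCast_le (by omega), ?_⟩
  have hf₂' : (s₂.setReg 16 n).Fits B := hf₂.setReg _ (by omega)
  refine (Runs.call hf₂' (hP (.of fun i k => if X.1 i k = a then 1 else 0,
    .of fun k j => if X.2 k j = b then 1 else 0) ((s₂.setReg 16 n).drop 16) (hf₂'.drop 16)
    ⟨fun i j => ?_, by simp, fun i j => ?_⟩)).mono ?_
  · simp only [Matrix.of_apply, pow_zero]
    constructor <;> split <;> simp
  · have e1 := hd₁ _ (fin_mul_add_lt i j)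
    have e2 := hd₂ _ (fin_mul_add_lt i j)
    have e3 : s₂.mem 16 = s₁.mem 16 := hm₂ 16 (by decide)
    rw [← e3] at e1
    simp only [Store.mem_setReg, (hXm i j).1] at e1
    simp only [Store.mem_setReg, hm₁ 1 (by decide), (hXm i j).2] at e2
    refine ⟨?_, ?_⟩
    · simpa using e1
    · simpa [q13] using e2
  rintro t₃ s₃ ⟨⟨ht₃, hout⟩, hf₃, hr₃, hm₃⟩
  have u1 : s₃.reg 1 = 1 := by simpa [r1] using hr₃ 1 (by decide)
  have u2 : s₃.reg 2 = 0 := by simpa [r2] using hr₃ 2 (by decide)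
  have u3 : s₃.reg 3 = (n * n : ℕ) := by simpa [r3] using hr₃ 3 (by decide)
  have u14 : s₃.reg 14 = a + b := by simpa [r14] using hr₃ 14 (by decide)
  have um2 : s₃.mem 2 = s.mem 2 := by
    rw [hm₃ 2 (by decide), Store.mem_setReg, hm₂ 2 (by decide), Store.mem_setReg,
      hm₁ 2 (by decide)]; rfl
  simp only [runs_block_cons, runs_block_nil, runs_arith, Op.eval, u2, u3, add_zero]
  refine ⟨abs_natCast_le (by omega), ?_⟩
  refine (runs_fill (N := n * n) (τ := 9) (fun p =>
    if 0 < s₃.mem 18 p ∧ s.mem 2 p < a + b then a + b else s.mem 2 p)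
    (by decide) (by simp) (by simp) (by simp) (hf₃.setReg _ (by omega)) (by simpa using u1)
    (by simp) ?_).mono ?_
  · intro m hm s₄ hf₄ hr₄ hm₄ v4 v2m
    have v2 : s₄.reg 2 = 0 := by simpa [u2] using hr₄ 2 (by decide) (by simp)
    have v14 : s₄.reg 14 = a + b := by simpa [u14] using hr₄ 14 (by decide) (by simp)
    have v18 : s₄.mem 18 = s₃.mem 18 := hm₄ 18 (by decide)
    rw [Store.mem_setReg, um2] at v2m
    have hFm := abs_le.1 (hF m hm)
    simp only [runs_block_cons, runs_block_nil, runs_arith, runs_load, runs_branch, runs_skip,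
      Op.eval, Store.reg_setReg_beq, Store.mem_setReg, Nat.reduceBEq, cond_true, cond_false,
      v2, v4, v14, v18, v2m, add_zero]
    split
    · next hpos =>
      refine ⟨abs_le.2 ⟨by omega, by omega⟩, ?_⟩
      split
      · exact ⟨abs_le.2 ⟨by omega, by omega⟩, by omega, by rw [if_pos ⟨hpos, by omega⟩]⟩
      · exact ⟨by omega, by rw [if_neg (by omega)]⟩
    · exact ⟨by omega, by rw [if_neg (by omega)]⟩
  · rintro t₄ s₄ ⟨ht₄, hd₄, -⟩
    refine ⟨by clear * - ht₁ ht₂ ht₃ ht₄; omega, fun i j => ?_⟩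
    rw [hd₄ _ (fin_mul_add_lt i j)]
    have hp := hout i j
    simp only [Store.drop_mem, Nat.reduceAdd] at hp
    simp only [hp, indicator_mul_indicator_pos]

/-- Quotient and remainder modulo `2 * M + 1`: the bounds on `b` and `b'` place `b + M` and `b' + M`
in `[0, 2M]`. -/
theorem code_injective {a b a' b' : ℤ} (hb : |b| ≤ M) (hb' : |b'| ≤ M)
    (h : (a + M) * (2 * M + 1) + (b + M) = (a' + M) * (2 * M + 1) + (b' + M)) :
    a = a' ∧ b = b' := by
  rw [abs_le] at hb hb'
  have ha : a = a' := by
    by_contra hne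
    rcases lt_or_gt_of_ne hne with h' | h' <;> nlinarith
  subst ha
  exact ⟨rfl, by linarith⟩

set_option maxHeartbeats 1000000 in
theorem runs_maxPlus (hB : 4 * M + 1 ≤ B) (hMB : (2 * M + 1) ^ 2 ≤ B) (hnB : n * n + 1 ≤ B)
    (hP : ∀ X, ∀ s : Store, s.Fits B → MatMulInput 0 n X s →
      Runs B P s fun t s' => t ≤ τ ∧ MatMulOutput n X s')
    {s : Store} (hs : s.Fits B) (hn : 1 ≤ n) (hX : MaxPlusInput M n X s) :
    Runs B (maxPlus M P) s fun t s' =>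
      t ≤ (2 * M + 1) ^ 2 * (τ + n * n * 40 + 42) + n * n * 10 + 20 ∧ MaxPlusOutput n X s' := by
  obtain ⟨hXM, h0, hXm⟩ := hX
  have c1 : |(1 : ℤ)| ≤ B := abs_natCast_le (p := 1) (by omega)
  have c0 : |(0 : ℤ)| ≤ B := abs_natCast_le (p := 0) (by omega)
  have cM : |((2 * M + 1 : ℕ) : ℤ)| ≤ B := abs_natCast_le (by omega)
  have hM2 : |(((2 * M + 1) ^ 2 : ℕ) : ℤ)| ≤ B := abs_natCast_le hMB
  have hpos : 0 < (2 * M + 1) ^ 2 := by positivity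
  have b1 : ((1 : ℤ).natAbs ≤ B) := by simp; omega
  have b2 : ((0 : ℤ).natAbs ≤ B) := by simp
  simp only [maxPlus, runs_block_cons, runs_block_nil, runs_const, runs_arith, Op.eval,
    Store.reg_setReg_beq, Nat.reduceBEq, cond_true, cond_false, h0, add_zero, ← Nat.cast_mul]
  refine ⟨c1, c0, abs_natCast_le (by omega), cM, abs_natCast_le (by omega),
    abs_le.2 ⟨by omega, by omega⟩, abs_natCast_le (by omega), ?_⟩
  refine (runs_fill (N := n * n) (τ := 1) (fun _ => -(2 * M)) (by decide) (by simp) (by simp)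
    (by simp) ?_ (by simp) (by simp) ?_).mono ?_
  · refine ((((((hs.setReg _ b1).setReg _ b2).setReg _ ?_).setReg _ ?_).setReg _ ?_).setReg _
      ?_).setReg _ ?_ <;> omega
  · intro m hm s₁ _ hr _ _ _
    have q5 : s₁.reg 5 = -(2 * M) := by simpa using hr 5 (by decide) (by simp)
    simp [q5]
  rintro t₁ s₁ ⟨ht₁, hd₁, hf₁, hr₁, hm₁⟩
  have q0 : s₁.reg 0 = n := by simpa [h0] using hr₁ 0 (by decide) (by simp)
  have q1 : s₁.reg 1 = 1 := by simpa using hr₁ 1 (by decide) (by simp)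
  have q2 : s₁.reg 2 = 0 := by simpa using hr₁ 2 (by decide) (by simp)
  have q3 : s₁.reg 3 = (n * n : ℕ) := by simpa using hr₁ 3 (by decide) (by simp)
  have q10 : s₁.reg 10 = (2 * M + 1 : ℕ) := by simpa using hr₁ 10 (by decide) (by simp)
  have q11 : s₁.reg 11 = M := by simpa using hr₁ 11 (by decide) (by simp)
  have m0 : s₁.mem 0 = s.mem 0 := hm₁ 0 (by decide)
  have m1 : s₁.mem 1 = s.mem 1 := hm₁ 1 (by decide)
  refine ⟨hM2, ?_⟩
  set code : ℤ → ℤ → ℤ := fun a b => (a + M) * (2 * M + 1) + (b + M) with hcode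
  -- Invariant: each entry dominates all sums whose code has been treated, and is either the start
  -- value or one of the sums. The start value `-2M` is a lower bound for all sums.
  refine (runs_countdown (N := (2 * M + 1) ^ 2) (τ := τ + n * n * 40 + 40)
    (fun q s' => ∀ i j : Fin n,
      (∀ k, (q : ℤ) ≤ code (X.1 i k) (X.2 k j) →
        X.1 i k + X.2 k j ≤ s'.mem 2 ((i * n + j : ℕ) : ℤ)) ∧
      (s'.mem 2 ((i * n + j : ℕ) : ℤ) = -(2 * M) ∨
        ∃ k, s'.mem 2 ((i * n + j : ℕ) : ℤ) = X.1 i k + X.2 k j))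
    (by decide) (by simp [maxPlusRound, indicator, P.not_writesReg_shift])
    (by simp [maxPlusRound, indicator, P.not_writesReg_shift])
    (hf₁.setReg _ (by rwa [Int.natAbs_natCast])) (by simpa using q1) (by simp) ?_ ?_).mono ?_
  · intro i j
    refine ⟨fun k hk => ?_, .inl (hd₁ _ (fin_mul_add_lt i j))⟩
    -- Initially nothing has been treated: every code is below `(2M + 1)^2`.
    exfalso
    have h1 := abs_le.1 (hXM i k).1
    have h2 := abs_le.1 (hXM k j).2
    have : (X.1 i k + M) * (2 * M + 1) ≤ (2 * M : ℤ) * (2 * M + 1) :=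
      mul_le_mul_of_nonneg_right (by omega) (by omega)
    rw [hcode] at hk
    push_cast at hk
    nlinarith
  · intro q hq s₂ hf₂ hr₂ hm₂ hI
    have hw : ∀ x, x < 16 → x ∉ [4, 5, 6, 7, 8, 12, 13, 14] →
        s₂.reg x = (s₁.setReg 8 (((2 * M + 1) ^ 2 : ℕ) : ℤ)).reg x := fun x hx hx' => by
      refine hr₂ x (by rintro rfl; simp at hx') ?_
      simp only [List.mem_cons, not_or] at hx'
      simp [maxPlusRound, indicator, P.not_writesReg_shift hx, hx']
      omega
    have k0 : s₂.mem 0 = s.mem 0 := (hm₂ 0 (by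
      simp [maxPlusRound, indicator, P.not_writesMem_shift])).trans m0
    have k1 : s₂.mem 1 = s.mem 1 := (hm₂ 1 (by
      simp [maxPlusRound, indicator, P.not_writesMem_shift])).trans m1
    have hF : ∀ i j : Fin n, |s₂.mem 2 ((i * n + j : ℕ) : ℤ)| ≤ 2 * M := fun i j => by
      rcases (hI i j).2 with h | ⟨k, h⟩
      · rw [h, abs_neg, abs_of_nonneg (by positivity)]
      · rw [h]
        have h1 := (hXM i k).1
        have h2 := (hXM k j).2
        exact (abs_add_le _ _).trans (by linarith)
    refine (runs_maxPlusRound (X := X) (a := (q / (2 * M + 1) : ℕ) - M)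
      (b := (q % (2 * M + 1) : ℕ) - M) hB hnB hP (hf₂.setReg _ (by
        rw [Int.natAbs_natCast]; omega)) hn ⟨hXM, ?_, ?_⟩ ?_ ?_ ?_ ?_ ?_ (q := q) (by simp)
        (by rwa [← sq]) rfl rfl ?_).mono ?_
    · simpa [q0] using hw 0 (by decide) (by decide)
    · intro i j
      rw [Store.mem_setReg, k0, k1]; exact hXm i j
    · simpa [q1] using hw 1 (by decide) (by decide)
    · simpa [q2] using hw 2 (by decide) (by decide)
    · simpa [q3] using hw 3 (by decide) (by decide)
    · simpa [q10] using hw 10 (by decide) (by decide)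
    · simpa [q11] using hw 11 (by decide) (by decide)
    · intro p hp
      obtain ⟨i, j, rfl⟩ := exists_fin_mul_add hp
      exact hF i j
    · rintro t s₃ ⟨ht, hs₃⟩
      refine ⟨ht, fun i j => ?_⟩
      rw [hs₃ i j, Store.mem_setReg]
      obtain ⟨hle, hex⟩ := hI i j
      set a : ℤ := (q / (2 * M + 1) : ℕ) - M with ha
      set b : ℤ := (q % (2 * M + 1) : ℕ) - M with hb
      have hmod : q % (2 * M + 1) < 2 * M + 1 := Nat.mod_lt _ (by omega)
      have hq' : (q : ℤ) = (a + M) * (2 * M + 1) + (b + M) := by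
        rw [ha, hb]
        have := Nat.div_add_mod' q (2 * M + 1)
        zify at this
        push_cast
        linarith
      constructor
      · intro k hk
        by_cases hqk : ((q + 1 : ℕ) : ℤ) ≤ code (X.1 i k) (X.2 k j)
        · have := hle k hqk
          split <;> omega
        · have e : code (X.1 i k) (X.2 k j) = q := by push_cast at hqk; omega
          rw [hq', hcode] at e
          obtain ⟨hX1, hX2⟩ := code_injective (hXM k j).2 (by rw [hb, abs_le]; omega) e
          rw [hX1, hX2]
          split
          · exact le_rfl
          · next h => exact not_lt.1 fun hlt => h ⟨⟨k, hX1, hX2⟩, hlt⟩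
      · split
        · next h =>
          obtain ⟨⟨k, h1, h2⟩, -⟩ := h
          exact .inr ⟨k, by rw [h1, h2]⟩
        · exact hex
  · rintro t₂ s₂ ⟨ht₂, hI, -⟩
    refine ⟨?_, fun i j => ?_⟩
    · have : (2 * M + 1) ^ 2 * (τ + n * n * 40 + 40 + 2) =
        (2 * M + 1) ^ 2 * (τ + n * n * 40 + 42) := by ring
      omega
    · obtain ⟨hle, hex⟩ := hI i j
      have hle' : ∀ k, X.1 i k + X.2 k j ≤ s₂.mem 2 ((i * n + j : ℕ) : ℤ) := fun k => by
        refine hle k ?_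
        have h1 := abs_le.1 (hXM i k).1
        have h2 := abs_le.1 (hXM k j).2
        have : 0 ≤ (X.1 i k + M) * (2 * M + 1) := mul_nonneg (by omega) (by omega)
        rw [hcode]
        push_cast
        omega
      refine ⟨?_, ?_⟩
      -- An entry still equal to `-2M` bounds all sums from above, while `-2M` bounds them from
      -- below; so any `k`, such as `0`, attains it.
      · rcases hex with h | ⟨k, h⟩
        · have h0 := hle' ⟨0, hn⟩
          have h1 := abs_le.1 (hXM i ⟨0, hn⟩).1
          have h2 := abs_le.1 (hXM ⟨0, hn⟩ j).2
          exact ⟨⟨0, hn⟩, by dsimp only; omega⟩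
        · exact ⟨k, h.symm⟩
      · rintro _ ⟨k, rfl⟩
        exact hle' k

end WordRAM

/-! ### Corner sums and addresses, one coordinate at a time. -/

theorem mem_centralCornerSums_zero {n : ℕ} {A : (Fin 0 → ℤ) → ℤ} {v : ℤ} :
    v ∈ centralCornerSums n A ↔ v = A ![] := by
  simp only [centralCornerSums, Set.mem_ofPred_eq, IsEmpty.forall_iff, true_and, Finset.univ_unique,
    Finset.sum_singleton]
  constructor
  · rintro ⟨_, _, rfl⟩
    exact congrArg A (Subsingleton.elim _ _)
  · rintro rfl
    exact ⟨![], ![], congrArg A (Subsingleton.elim _ _)⟩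

theorem sum_corners_succ {d : ℕ} (A : (Fin (d + 1) → ℤ) → ℤ) (i δ : Fin (d + 1) → ℤ) :
    ∑ j : Fin (d + 1) → Fin 2, A (fun r => i r - δ r * ((j r : ℕ) : ℤ)) =
      ∑ j : Fin d → Fin 2,
        (A (Fin.cons (i 0) fun r => Fin.tail i r - Fin.tail δ r * ((j r : ℕ) : ℤ)) +
          A (Fin.cons (i 0 - δ 0) fun r => Fin.tail i r - Fin.tail δ r * ((j r : ℕ) : ℤ))) := by
  rw [← (Fin.consEquiv fun _ => Fin 2).sum_comp, Fintype.sum_prod_type, Fin.sum_univ_two,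
    ← Finset.sum_add_distrib]
  refine Finset.sum_congr rfl fun j _ => ?_
  congr 2 <;>
  · funext r
    refine Fin.cases ?_ (fun r => ?_) r <;> simp [Fin.consEquiv, Fin.tail]

/-- Splitting the corners by their first coordinate adds two slices. With `i 0 = x + 1` and `δ 0 = x
+ y + 2`, the constraints in that coordinate say exactly that `x, y < n`. -/
theorem mem_centralCornerSums_succ {d n : ℕ} {A : (Fin (d + 1) → ℤ) → ℤ} {v : ℤ} :
    v ∈ centralCornerSums n A ↔ ∃ x y : Fin n, v ∈ centralCornerSums n
      fun w => A (Fin.cons ((x : ℤ) + 1) w) + A (Fin.cons (-((y : ℤ) + 1)) w) := by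
  constructor
  · rintro ⟨i, δ, hi, hδ, hiδ, rfl⟩
    have h0 := hi 0
    have h1 := hiδ 0
    refine ⟨⟨(i 0 - 1).toNat, by omega⟩, ⟨(δ 0 - i 0 - 1).toNat, by omega⟩, Fin.tail i, Fin.tail δ,
      fun r => hi _, fun r => hδ _, fun r => hiδ _, ?_⟩
    rw [sum_corners_succ]
    refine Finset.sum_congr rfl fun j _ => ?_
    have e1 : (((i 0 - 1).toNat : ℕ) : ℤ) + 1 = i 0 := by omega
    have e2 : -((((δ 0 - i 0 - 1).toNat : ℕ) : ℤ) + 1) = i 0 - δ 0 := by omega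
    simp only [e1, e2]
  · rintro ⟨x, y, i, δ, hi, hδ, hiδ, rfl⟩
    have hx := x.2
    have hy := y.2
    refine ⟨Fin.cons ((x : ℤ) + 1) i, Fin.cons ((x : ℤ) + 1 + ((y : ℤ) + 1)) δ, ?_, ?_, ?_, ?_⟩
    · exact Fin.cases (by simp only [Fin.cons_zero]; omega) fun r => by simpa using hi r
    · exact Fin.cases (by simp only [Fin.cons_zero]; omega) fun r => by simpa using hδ r
    · exact Fin.cases (by simp only [Fin.cons_zero]; omega) fun r => by simpa using hiδ r
    · rw [sum_corners_succ]
      simp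

/-- The first coordinate is the lowest digit in base `2 * n + 1`, so a slice is read with stride `2
* n + 1`. -/
theorem centralAddress_cons {d n : ℕ} (a : ℤ) (w : Fin d → ℤ) :
    centralAddress n (Fin.cons a w : Fin (d + 1) → ℤ) =
      (a + n) + (2 * n + 1) * centralAddress n w := by
  simp only [centralAddress, Fin.sum_univ_succ, Fin.cons_zero, Fin.cons_succ, Fin.val_zero,
    pow_zero, mul_one, Fin.val_succ, Finset.mul_sum]
  congr 1
  refine Finset.sum_congr rfl fun r _ => ?_
  ring

theorem inCentralBox_cons {d n : ℕ} {a : ℤ} {w : Fin d → ℤ} :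
    InCentralBox n (Fin.cons a w : Fin (d + 1) → ℤ) ↔ (-(n : ℤ) ≤ a ∧ a ≤ n) ∧ InCentralBox n w := by
  simp [InCentralBox, Fin.forall_fin_succ]

theorem exists_centralAddress_eq {d n : ℕ} : ∀ {p : ℕ}, p < (2 * n + 1) ^ d →
    ∃ v : Fin d → ℤ, InCentralBox n v ∧ centralAddress n v = p := by
  induction d with
  | zero =>
    intro p hp
    exact ⟨![], fun r => r.elim0, by simp [centralAddress]; simp at hp; omega⟩
  | succ d ih =>
    intro p hp
    obtain ⟨w, hw, hwa⟩ := ih (p := p / (2 * n + 1)) (by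
      rw [pow_succ'] at hp; exact Nat.div_lt_of_lt_mul hp)
    have hmod : p % (2 * n + 1) < 2 * n + 1 := Nat.mod_lt _ (by omega)
    refine ⟨Fin.cons ((p % (2 * n + 1) : ℕ) - n) w, inCentralBox_cons.2 ⟨⟨by omega, by omega⟩, hw⟩, ?_⟩
    rw [centralAddress_cons, hwa]
    have := Nat.mod_add_div p (2 * n + 1)
    zify at this
    push_cast
    linarith

theorem centralAddress_mem {d n : ℕ} {v : Fin d → ℤ} (hv : InCentralBox n v) :
    ∃ p : ℕ, p < (2 * n + 1) ^ d ∧ centralAddress n v = p := by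
  induction d with
  | zero => exact ⟨0, by simp, by simp [centralAddress]⟩
  | succ d ih =>
    induction v using Fin.consCases with
    | _ a w =>
      rw [inCentralBox_cons] at hv
      obtain ⟨p, hp, hpw⟩ := ih hv.2
      refine ⟨(a + n).toNat + (2 * n + 1) * p, ?_, ?_⟩
      · have h1 : (a + n).toNat < 2 * n + 1 := by omega
        rw [pow_succ']
        nlinarith
      · rw [centralAddress_cons, hpw]
        push_cast
        rw [Int.toNat_of_nonneg (by omega)]

/-- Adding two slices doubles the bound in each dimension. This provides start values for the maxima
and keeps results within a word. -/
theorem abs_le_of_mem_centralCornerSums {d n : ℕ} : ∀ {M : ℕ} {A : (Fin d → ℤ) → ℤ} {v : ℤ},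
    (∀ w, InCentralBox n w → |A w| ≤ M) → v ∈ centralCornerSums n A → |v| ≤ (2 ^ d * M : ℕ) := by
  induction d with
  | zero =>
    intro M A v hA hv
    rw [mem_centralCornerSums_zero] at hv
    simpa [hv] using hA ![] fun r => r.elim0
  | succ d ih =>
    intro M A v hA hv
    obtain ⟨x, y, hv⟩ := mem_centralCornerSums_succ.1 hv
    have hx := x.2
    have hy := y.2
    refine (ih (M := 2 * M) (fun w hw => ?_) hv).trans (le_of_eq (by push_cast; ring))
    have h1 := hA (Fin.cons ((x : ℤ) + 1) w) (inCentralBox_cons.2 ⟨⟨by omega, by omega⟩, hw⟩)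
    have h2 := hA (Fin.cons (-((y : ℤ) + 1)) w) (inCentralBox_cons.2 ⟨⟨by omega, by omega⟩, hw⟩)
    refine (abs_add_le _ _).trans ?_
    push_cast
    linarith

theorem centralCornerSums_nonempty {d n : ℕ} (hn : 1 ≤ n) (A : (Fin d → ℤ) → ℤ) :
    (centralCornerSums n A).Nonempty :=
  ⟨_, fun _ => 1, fun _ => 2, fun _ => by dsimp only; omega,
    fun _ => by dsimp only; omega, fun _ => by dsimp only; omega, rfl⟩

/-- The `k`-th index of the positive or of the negative half. -/
def halfIndex (σ : Bool) (k : ℕ) : ℤ := bif σ then (k : ℤ) + 1 else -((k : ℤ) + 1)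

theorem halfIndex_bounds (σ : Bool) {k n : ℕ} (hk : k < n) :
    -(n : ℤ) ≤ halfIndex σ k ∧ halfIndex σ k ≤ n := by
  cases σ <;> simp only [halfIndex, cond_true, cond_false] <;> omega

/-- The square matrix of the entries of a two-dimensional array in one of the four quadrants. -/
def quadrant (n : ℕ) (A : (Fin 2 → ℤ) → ℤ) (σ ρ : Bool) : Matrix (Fin n) (Fin n) ℤ :=
  .of fun i k => A ![halfIndex σ i, halfIndex ρ k]

/-! ### Dimension two by two max-plus products. -/

namespace WordRAM

/-- Replace the number in the register `r` by the offset of an index of a half. -/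
def half (r : ℕ) : Bool → Prog
  | true => block [.arith .add r r 1, .arith .add r r 0]
  | false => block [.arith .sub r 0 r, .arith .sub r r 1]

/-- Load the entry of a quadrant at the address in register `4`; with `sw`, of the transposed
quadrant. -/
def gather (sw σ ρ : Bool) : Prog :=
  block [.arith .div (bif sw then 7 else 6) 4 0,
    .arith .mul (bif sw then 6 else 7) (bif sw then 7 else 6) 0,
    .arith .sub (bif sw then 6 else 7) 4 (bif sw then 6 else 7),
    half 6 σ, half 7 ρ, .arith .mul 7 7 10, .arith .add 6 6 7, .load 5 0 6]

/-- Maximum over the second index in one half, by a max-plus product. -/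
def quadrantRound (P : Prog) (ρ : Bool) : Prog :=
  block [.arith .add 4 3 2, fill 4 16 5 (gather false true ρ),
    .arith .add 4 3 2, fill 4 17 5 (gather true false ρ),
    .arith .add 16 0 2, P.shift 16]

/-- Central Maximum Subarray Sum in dimension two by two max-plus products. -/
def centralTwo (M : ℕ) (P : Prog) : Prog :=
  block [.const 1 1, .const 2 0, .arith .mul 3 0 0, .arith .add 10 0 0, .arith .add 10 10 1,
    -- The second call may overwrite array `18`, so the first product is saved in array `1`.
    quadrantRound P true, .arith .add 4 3 2, fill 4 1 5 (.load 5 18 4), quadrantRound P false,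
    .const 9 (-(4 * M)), .arith .add 4 3 2,
    countdown 4 (block [.load 6 1 4, .load 7 18 4, .arith .add 6 6 7, .arith .sub 7 6 9,
      .branch 7 (.arith .add 9 6 2) .skip]),
    .arith .add 0 9 2]

variable {B M n τ : ℕ} {P : Prog} {A : (Fin 2 → ℤ) → ℤ}

theorem runs_gather (sw σ ρ : Bool) {N : ℕ} {s : Store} (hB : (2 * n + 1) * (2 * n + 1) ≤ B)
    (h0 : s.reg 0 = n) (h1 : s.reg 1 = 1) (h4 : s.reg 4 = N) (h10 : s.reg 10 = (2 * n + 1 : ℕ))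
    (hN : N < n * n) :
    Runs B (gather sw σ ρ) s fun t s' => t ≤ 13 ∧
      s'.reg 5 = s.mem 0 (halfIndex σ (bif sw then N % n else N / n) + n +
        (2 * n + 1) * (halfIndex ρ (bif sw then N / n else N % n) + n)) := by
  have hd : N / n < n := Nat.div_lt_of_lt_mul hN
  have hmod : N % n < n := Nat.mod_lt _ (Nat.pos_of_ne_zero (by rintro rfl; simp at hN))
  have hdm : N / n * n ≤ N := Nat.div_mul_le_self N n
  have hB' : ((2 * n + 1) * (2 * n + 1) : ℤ) ≤ B := by exact_mod_cast hB
  have hnn : (n * n : ℕ) ≤ B := by nlinarith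
  have hnB : 2 * n + 1 ≤ B := by nlinarith
  have e : (N : ℤ) - ((N / n : ℕ) : ℤ) * n = (N % n : ℕ) := natCast_sub_div_mul N n
  have e' : (N : ℤ) / n = (N / n : ℕ) := (Int.natCast_ediv N n).symm
  generalize N / n = a at *
  generalize N % n = b at *
  have c1 : |((a : ℕ) : ℤ)| ≤ B := abs_natCast_le (by omega)
  have c2 : |((b : ℕ) : ℤ)| ≤ B := abs_natCast_le (by omega)
  have c3 : |((a * n : ℕ) : ℤ)| ≤ B := abs_natCast_le (by omega)
  rw [Nat.cast_mul] at c3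
  have key : ∀ x y : ℤ, 0 ≤ x → x ≤ 2 * n → 0 ≤ y → y ≤ 2 * n →
      |y * ((2 * n + 1 : ℕ) : ℤ)| ≤ B ∧ |x + y * ((2 * n + 1 : ℕ) : ℤ)| ≤ B := by
    intro x y hx hx' hy hy'
    have h : 0 ≤ y * ((2 * n + 1 : ℕ) : ℤ) := by positivity
    have h' : y * ((2 * n + 1 : ℕ) : ℤ) ≤ 2 * n * (2 * n + 1) := by
      push_cast
      exact mul_le_mul_of_nonneg_right hy' (by positivity)
    constructor <;> rw [abs_of_nonneg (by omega)] <;> nlinarith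
  cases sw <;> cases σ <;> cases ρ <;>
  · simp only [gather, half, runs_block_cons, runs_block_nil, runs_arith, runs_load, Op.eval,
      Store.reg_setReg_beq, Store.mem_setReg, Nat.reduceBEq, cond_true, cond_false, h0, h1, h4, h10,
      e, e', halfIndex]
    refine ⟨c1, c3, c2, abs_le.2 ⟨by omega, by omega⟩, abs_le.2 ⟨by omega, by omega⟩,
      abs_le.2 ⟨by omega, by omega⟩, abs_le.2 ⟨by omega, by omega⟩,
      (key 0 _ (by omega) (by omega) (by omega) (by omega)).1,
      (key _ _ (by omega) (by omega) (by omega) (by omega)).2, by omega, ?_⟩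
    congr 1
    push_cast
    ring

theorem writesReg_gather {sw σ ρ : Bool} {x : ℕ} (h : (gather sw σ ρ).WritesReg x) :
    x = 5 ∨ x = 6 ∨ x = 7 := by
  revert h
  cases sw <;> cases σ <;> cases ρ <;> simp [gather, half] <;> omega

theorem not_writesMem_gather {sw σ ρ : Bool} {a : ℕ} : ¬ (gather sw σ ρ).WritesMem a := by
  cases sw <;> cases σ <;> cases ρ <;> simp [gather, half]

theorem centralAddress_two (x y : ℤ) :
    centralAddress n ![x, y] = x + n + (2 * n + 1) * (y + n) := by
  simp [centralAddress, Fin.sum_univ_two]; ring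

theorem inCentralBox_two {x y : ℤ} : InCentralBox n ![x, y] ↔
    (-(n : ℤ) ≤ x ∧ x ≤ n) ∧ (-(n : ℤ) ≤ y ∧ y ≤ n) := by
  simp [InCentralBox, Fin.forall_fin_succ]

/-- Transposing the second quadrant makes the shared second coordinate the inner index of the
product. -/
theorem runs_quadrantRound (ρ : Bool) (hB : (2 * n + 1) * (2 * n + 1) ≤ B)
    (hP : ∀ X, ∀ s : Store, s.Fits B → MaxPlusInput M n X s →
      Runs B P s fun t s' => t ≤ τ ∧ MaxPlusOutput n X s')
    {s : Store} (hs : s.Fits B) (hA : ∀ v, InCentralBox n v → |A v| ≤ M) (h0 : s.reg 0 = n)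
    (hm : ∀ v, InCentralBox n v → s.mem 0 (centralAddress n v) = A v)
    (h1 : s.reg 1 = 1) (h2 : s.reg 2 = 0) (h3 : s.reg 3 = (n * n : ℕ))
    (h10 : s.reg 10 = (2 * n + 1 : ℕ)) :
    Runs B (quadrantRound P ρ) s fun t s' => t ≤ τ + n * n * 32 + 10 ∧
      (∀ i j : Fin n, IsGreatest
        (Set.range fun k => quadrant n A true ρ i k + (quadrant n A false ρ).transpose k j)
        (s'.mem 18 ((i * n + j : ℕ) : ℤ))) ∧ s'.Fits B ∧
      (∀ x, x < 16 → ¬ (x = 4 ∨ x = 5 ∨ x = 6 ∨ x = 7) → s'.reg x = s.reg x) ∧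
      ∀ a, a < 16 → s'.mem a = s.mem a := by
  have hnn : n * n ≤ B := by nlinarith
  have hnB : 2 * n + 1 ≤ B := by nlinarith
  have hfill : ∀ (sw σ : Bool) (a : ℕ) (s₁ : Store), a ≠ 0 → s₁.Fits B → s₁.reg 0 = n →
      s₁.reg 1 = 1 → s₁.reg 4 = (n * n : ℕ) → s₁.reg 10 = (2 * n + 1 : ℕ) →
      Runs B (fill 4 a 5 (gather sw σ ρ)) s₁ fun t s' => t ≤ n * n * 16 + 1 ∧
        (∀ p : ℕ, p < n * n → s'.mem a p =
          s₁.mem 0 (halfIndex σ (bif sw then p % n else p / n) + n +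
            (2 * n + 1) * (halfIndex ρ (bif sw then p / n else p % n) + n))) ∧ s'.Fits B ∧
        (∀ x, ¬ (x = 4 ∨ x = 5 ∨ x = 6 ∨ x = 7) → s'.reg x = s₁.reg x) ∧
        ∀ b, b ≠ a → s'.mem b = s₁.mem b := by
    intro sw σ a s₁ ha hf k0 k1 k4 k10
    have hw : ∀ x, ¬ (x = 5 ∨ x = 6 ∨ x = 7) → ¬ (gather sw σ ρ).WritesReg x :=
      fun x hx h => hx (writesReg_gather h)
    refine (runs_fill (τ := 13) (fun p => s₁.mem 0 (halfIndex σ (bif sw then p % n else p / n) + n +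
      (2 * n + 1) * (halfIndex ρ (bif sw then p / n else p % n) + n))) (by decide) (hw 4 (by decide)) (hw 1 (by decide))
      (fun _ => not_writesMem_gather) hf k1 k4 ?_).mono ?_
    · intro m hm s₂ _ hr hm₂ l4 _
      have l0 := (hr 0 (by decide) (hw 0 (by decide))).trans k0
      have l1 := (hr 1 (by decide) (hw 1 (by decide))).trans k1
      have l10 := (hr 10 (by decide) (hw 10 (by decide))).trans k10
      have := runs_gather sw σ ρ hB l0 l1 l4 l10 hm
      rwa [hm₂ 0 ha.symm] at this
    · rintro t s' ⟨ht, hd, hf', hr, hm'⟩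
      exact ⟨ht, hd, hf', fun x hx => hr x (by omega) (hw x (by omega)), hm'⟩
  simp only [quadrantRound, runs_block_cons, runs_arith, Op.eval, h2, h3, add_zero]
  refine ⟨abs_natCast_le hnn, ?_⟩
  refine (hfill false true 16 _ (by decide) (hs.setReg _ (by omega)) (by simpa using h0)
    (by simpa using h1) (by simp) (by simpa using h10)).mono ?_
  rintro t₁ s₁ ⟨ht₁, hd₁, hf₁, hr₁, hm₁⟩
  have q0 : s₁.reg 0 = n := by simpa [h0] using hr₁ 0 (by decide)
  have q1 : s₁.reg 1 = 1 := by simpa [h1] using hr₁ 1 (by decide)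
  have q2 : s₁.reg 2 = 0 := by simpa [h2] using hr₁ 2 (by decide)
  have q3 : s₁.reg 3 = (n * n : ℕ) := by simpa [h3] using hr₁ 3 (by decide)
  have q10 : s₁.reg 10 = (2 * n + 1 : ℕ) := by simpa [h10] using hr₁ 10 (by decide)
  simp only [q2, q3, add_zero]
  refine ⟨abs_natCast_le hnn, ?_⟩
  refine (hfill true false 17 _ (by decide) (hf₁.setReg _ (by omega)) (by simpa using q0)
    (by simpa using q1) (by simp) (by simpa using q10)).mono ?_
  rintro t₂ s₂ ⟨ht₂, hd₂, hf₂, hr₂, hm₂⟩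
  have r0 : s₂.reg 0 = n := by simpa [q0] using hr₂ 0 (by decide)
  have r2 : s₂.reg 2 = 0 := by simpa [q2] using hr₂ 2 (by decide)
  simp only [r0, r2, add_zero]
  refine ⟨abs_natCast_le (by omega), ?_⟩
  have hf₂' : (s₂.setReg 16 n).Fits B := hf₂.setReg _ (by omega)
  have hbox : ∀ (σ : Bool) (i k : Fin n), InCentralBox n ![halfIndex σ i, halfIndex ρ k] :=
    fun σ i k => inCentralBox_two.2 ⟨halfIndex_bounds σ i.2, halfIndex_bounds ρ k.2⟩
  refine (Runs.call hf₂' (hP (quadrant n A true ρ, (quadrant n A false ρ).transpose)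
    ((s₂.setReg 16 n).drop 16) (hf₂'.drop 16)
    ⟨fun i j => ⟨hA _ (hbox _ _ _), hA _ (hbox _ _ _)⟩, by simp, fun i j => ?_⟩)).mono ?_
  · have e1 := hd₁ _ (fin_mul_add_lt i j)
    have e2 := hd₂ _ (fin_mul_add_lt i j)
    have e3 : s₂.mem 16 = s₁.mem 16 := hm₂ 16 (by decide)
    have e4 : s₁.mem 0 = s.mem 0 := hm₁ 0 (by decide)
    rw [← e3] at e1
    simp only [Store.mem_setReg, cond_true, cond_false, fin_mul_add_div, fin_mul_add_mod, e4,
      ← centralAddress_two, hm _ (hbox _ _ _)] at e1 e2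
    exact ⟨e1, e2⟩
  rintro t₃ s₃ ⟨⟨ht₃, hout⟩, hf₃, hr₃, hm₃⟩
  rw [runs_block_nil]
  refine ⟨by clear * - ht₁ ht₂ ht₃; omega, hout, hf₃, fun x hx hx' => ?_, fun a ha => ?_⟩
  · have hx4 : x ≠ 4 := by omega
    have hx16 : x ≠ 16 := by omega
    rw [hr₃ x hx, Store.reg_setReg, if_neg hx16, hr₂ x hx', Store.reg_setReg, if_neg hx4,
      hr₁ x hx', Store.reg_setReg, if_neg hx4]
  · rw [hm₃ a ha, Store.mem_setReg, hm₂ a (by omega), Store.mem_setReg, hm₁ a (by omega)]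
    rfl

/-- The index `k` occurs only in the first bracket and `l` only in the second, so for fixed `i`, `j`
they can be optimised separately. -/
theorem mem_centralCornerSums_two {v : ℤ} : v ∈ centralCornerSums n A ↔ ∃ i j k l : Fin n, v =
    (quadrant n A true true i k + (quadrant n A false true).transpose k j) +
      (quadrant n A true false i l + (quadrant n A false false).transpose l j) := by
  simp only [mem_centralCornerSums_succ, mem_centralCornerSums_zero]
  refine exists_congr fun i => exists_congr fun j => exists_congr fun k => exists_congr fun l => ?_
  rfl

set_option maxHeartbeats 1000000 in
theorem runs_centralTwo (hB : (2 * n + 1) * (2 * n + 1) ≤ B) (hMB : 8 * M ≤ B) (hn : 1 ≤ n)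
    (hP : ∀ X, ∀ s : Store, s.Fits B → MaxPlusInput M n X s →
      Runs B P s fun t s' => t ≤ τ ∧ MaxPlusOutput n X s')
    {s : Store} (hs : s.Fits B) (hA : CentralInput 2 M n A s) :
    Runs B (centralTwo M P) s fun t s' => t ≤ 2 * τ + n * n * 100 + 100 ∧
      CentralOutput 2 n A s' := by
  obtain ⟨hAM, h0, hm⟩ := hA
  have hAM' : ∀ v, InCentralBox n v → |A v| ≤ M := fun v hv => by
    rw [Int.abs_eq_natAbs, Nat.cast_le]; exact hAM v hv
  have hnn : n * n ≤ B := by nlinarith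
  have hnB : 2 * n + 1 ≤ B := by nlinarith
  have c1 : |(1 : ℤ)| ≤ B := abs_natCast_le (p := 1) (by omega)
  have c0 : |(0 : ℤ)| ≤ B := abs_natCast_le (p := 0) (by omega)
  have e10 : (n : ℤ) + n + 1 = (2 * n + 1 : ℕ) := by push_cast; ring
  have b1 : ((1 : ℤ).natAbs ≤ B) := by simp; omega
  have b2 : ((0 : ℤ).natAbs ≤ B) := by simp
  simp only [centralTwo, runs_block_cons, runs_block_nil, runs_const, runs_arith, Op.eval,
    Store.reg_setReg_beq, Nat.reduceBEq, cond_true, cond_false, h0, e10, ← Nat.cast_mul]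
  refine ⟨c1, c0, abs_natCast_le hnn, abs_le.2 ⟨by omega, by omega⟩, abs_natCast_le hnB, ?_⟩
  refine (runs_quadrantRound (A := A) true hB hP ?_ hAM' ?_ ?_ ?_ ?_ ?_ ?_).mono ?_
  · refine ((((hs.setReg _ b1).setReg _ b2).setReg _ ?_).setReg _ ?_).setReg _ ?_ <;> omega
  · simpa using h0
  · exact hm
  · simp
  · simp
  · simp
  · simp
  rintro t₁ s₁ ⟨ht₁, hG₁, hf₁, hr₁, hm₁⟩
  have q0 : s₁.reg 0 = n := by simpa [h0] using hr₁ 0 (by decide) (by decide)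
  have q1 : s₁.reg 1 = 1 := by simpa using hr₁ 1 (by decide) (by decide)
  have q2 : s₁.reg 2 = 0 := by simpa using hr₁ 2 (by decide) (by decide)
  have q3 : s₁.reg 3 = (n * n : ℕ) := by simpa using hr₁ 3 (by decide) (by decide)
  have q10 : s₁.reg 10 = (2 * n + 1 : ℕ) := by simpa using hr₁ 10 (by decide) (by decide)
  simp only [q2, q3, add_zero]
  refine ⟨abs_natCast_le hnn, ?_⟩
  refine (runs_fill (N := n * n) (τ := 1) (fun p => s₁.mem 18 p) (by decide) (by simp) (by simp)
    (by simp) (hf₁.setReg _ (by omega)) (by simpa using q1) (by simp) ?_).mono ?_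
  · intro m hm s₂ _ _ hm₂ l4 _
    simp [l4, hm₂ 18 (by decide)]
  rintro t₂ s₂ ⟨ht₂, hd₂, hf₂, hr₂, hm₂⟩
  have r0 : s₂.reg 0 = n := by simpa [q0] using hr₂ 0 (by decide) (by simp)
  have r1 : s₂.reg 1 = 1 := by simpa [q1] using hr₂ 1 (by decide) (by simp)
  have r2 : s₂.reg 2 = 0 := by simpa [q2] using hr₂ 2 (by decide) (by simp)
  have r3 : s₂.reg 3 = (n * n : ℕ) := by simpa [q3] using hr₂ 3 (by decide) (by simp)
  have r10 : s₂.reg 10 = (2 * n + 1 : ℕ) := by simpa [q10] using hr₂ 10 (by decide) (by simp)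
  refine (runs_quadrantRound (A := A) false hB hP hf₂ hAM' r0 (fun v hv => ?_) r1 r2 r3 r10).mono ?_
  · rw [hm₂ 0 (by decide), Store.mem_setReg, hm₁ 0 (by decide)]
    exact hm v hv
  rintro t₃ s₃ ⟨ht₃, hG₃, hf₃, hr₃, hm₃⟩
  have u1 : s₃.reg 1 = 1 := (hr₃ 1 (by decide) (by decide)).trans r1
  have u2 : s₃.reg 2 = 0 := (hr₃ 2 (by decide) (by decide)).trans r2
  have u3 : s₃.reg 3 = (n * n : ℕ) := (hr₃ 3 (by decide) (by decide)).trans r3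
  have um1 : ∀ p < n * n, s₃.mem 1 p = s₁.mem 18 p := fun p hp => by
    rw [hm₃ 1 (by decide), hd₂ p hp]
  simp only [Store.reg_setReg_beq, Nat.reduceBEq, cond_true, cond_false, u2, u3, add_zero]
  refine ⟨abs_le.2 ⟨by omega, by omega⟩, abs_natCast_le hnn, ?_⟩
  set g : ℕ → ℤ := fun p => s₃.mem 1 p + s₃.mem 18 p with hg
  have hF : ∀ i j : Fin n, IsGreatest (Set.range fun k =>
      quadrant n A true true i k + (quadrant n A false true).transpose k j)
      (s₃.mem 1 ((i * n + j : ℕ) : ℤ)) := fun i j => by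
    rw [um1 _ (fin_mul_add_lt i j)]; exact hG₁ i j
  have hgmem : ∀ p < n * n, g p ∈ centralCornerSums n A := by
    intro p hp
    obtain ⟨i, j, rfl⟩ := exists_fin_mul_add hp
    obtain ⟨k, hk⟩ := (hF i j).1
    obtain ⟨l, hl⟩ := (hG₃ i j).1
    exact mem_centralCornerSums_two.2 ⟨i, j, k, l, congrArg₂ (· + ·) hk.symm hl.symm⟩
  have hgle : ∀ v ∈ centralCornerSums n A, ∃ p < n * n, v ≤ g p := by
    intro v hv
    obtain ⟨i, j, k, l, rfl⟩ := mem_centralCornerSums_two.1 hv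
    exact ⟨_, fin_mul_add_lt i j, add_le_add ((hF i j).2 ⟨k, rfl⟩) ((hG₃ i j).2 ⟨l, rfl⟩)⟩
  have hgM : ∀ p < n * n, |g p| ≤ (4 * M : ℕ) := fun p hp =>
    abs_le_of_mem_centralCornerSums hAM' (hgmem p hp)
  -- The start value `-4M` is a lower bound for sums of four entries; if it survives to the end, it
  -- is itself such a sum.
  refine (runs_countdown (N := n * n) (τ := 9) (fun m s' =>
    (∀ p : ℕ, m ≤ p → p < n * n → g p ≤ s'.reg 9) ∧
      (s'.reg 9 = -(4 * M) ∨ ∃ p < n * n, s'.reg 9 = g p)) (by decide) (by simp) (by simp)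
    ((hf₃.setReg _ (by omega)).setReg _ (by omega)) (by simpa using u1) (by simp)
    ⟨fun p h h' => absurd h' h.not_gt, by simp⟩ ?_).mono ?_
  · intro m hm s₄ hf₄ hr₄ hm₄ ⟨hle, hex⟩
    have v2 : s₄.reg 2 = 0 := by simpa [u2] using hr₄ 2 (by decide) (by simp)
    have v1m : s₄.mem 1 = s₃.mem 1 := hm₄ 1 (by simp)
    have v18 : s₄.mem 18 = s₃.mem 18 := hm₄ 18 (by simp)
    have hgm := abs_le.1 (hgM m hm)
    have h9 : -(4 * M : ℤ) ≤ s₄.reg 9 ∧ s₄.reg 9 ≤ 4 * M := by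
      rcases hex with h | ⟨p, hp, h⟩
      · omega
      · have := abs_le.1 (hgM p hp)
        push_cast at this
        rwa [h]
    simp only [runs_block_cons, runs_block_nil, runs_arith, runs_load, runs_branch, runs_skip,
      Op.eval, Store.reg_setReg_beq, Store.mem_setReg, Nat.reduceBEq, cond_true, cond_false,
      v2, v1m, v18, add_zero]
    change |g m| ≤ _ ∧ |g m - _| ≤ _ ∧ if 0 < g m - _ then |g m| ≤ _ ∧ _ ∧
      (∀ p : ℕ, _ → _ → _ ≤ g m) ∧ (g m = _ ∨ ∃ p < n * n, g m = _) else _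
    have hgB : |g m| ≤ B := abs_le.2 ⟨by omega, by omega⟩
    refine ⟨hgB, abs_le.2 ⟨by omega, by omega⟩, ?_⟩
    split
    · refine ⟨hgB, by omega, fun p hp hpn => ?_, .inr ⟨m, hm, rfl⟩⟩
      rcases hp.eq_or_lt with rfl | hp
      · exact le_rfl
      · have := hle p hp hpn
        omega
    · refine ⟨by omega, fun p hp hpn => ?_, hex⟩
      rcases hp.eq_or_lt with rfl | hp
      · omega
      · exact hle p hp hpn
  · rintro t₄ s₄ ⟨ht₄, ⟨hle, hex⟩, hf₄, hr₄, -⟩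
    have v2 : s₄.reg 2 = 0 := by simpa [u2] using hr₄ 2 (by decide) (by simp)
    have h9 : s₄.reg 9 ∈ centralCornerSums n A := by
      rcases hex with h | ⟨p, hp, h⟩
      · have h00 : 0 < n * n := by positivity
        have h1 := hle 0 le_rfl h00
        have h2 := abs_le.1 (hgM 0 h00)
        have : s₄.reg 9 = g 0 := by push_cast at h2; omega
        rw [this]
        exact hgmem 0 h00
      · rw [h]; exact hgmem p hp
    simp only [v2, add_zero]
    refine ⟨?_, by clear * - ht₁ ht₂ ht₃ ht₄; omega, ?_⟩
    · rw [Int.abs_eq_natAbs, Nat.cast_le]; exact hf₄.1 9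
    · rw [CentralOutput, Store.reg_setReg, if_pos rfl]
      refine ⟨h9, fun v hv => ?_⟩
      obtain ⟨p, hp, hv⟩ := hgle v hv
      exact hv.trans (hle p (Nat.zero_le _) hp)

end WordRAM

/-- The sum of two slices of an array, one from each half of the first coordinate. -/
def sliceSum {d : ℕ} (A : (Fin (d + 1) → ℤ) → ℤ) (x y : ℕ) (w : Fin d → ℤ) : ℤ :=
  A (Fin.cons ((x : ℤ) + 1) w) + A (Fin.cons (-((y : ℤ) + 1)) w)

/-! ### From dimension `d` to dimension `d + 1`. -/

namespace WordRAM

/-- Add up the two slices that are coded by register `7`, and raise register `9` to the central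
maximum subarray sum of the result. -/
def sliceRound (P : Prog) : Prog :=
  -- With `x * n + y` in register `7`, registers `11` and `12` end up with `x + 1 + n` and `n - y -
  -- 1`, the lowest address digits of the two slices.
  block [.arith .div 11 7 0, .arith .mul 12 11 0, .arith .sub 12 7 12,
    .arith .add 11 11 1, .arith .add 11 11 0, .arith .sub 12 0 12, .arith .sub 12 12 1,
    .arith .add 4 10 2,
    fill 4 16 5 (block [.arith .mul 6 4 3, .arith .add 13 6 11, .load 13 0 13,
      .arith .add 14 6 12, .load 14 0 14, .arith .add 5 13 14]),
    .arith .add 16 0 2, P.shift 16,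
    .arith .sub 13 16 9, .branch 13 (.arith .add 9 16 2) .skip]

/-- Central Maximum Subarray Sum in dimension `d + 1`, by means of the program `P` for
dimension `d`. -/
def centralSucc (d M : ℕ) (P : Prog) : Prog :=
  block [.const 1 1, .const 2 0, .arith .add 3 0 0, .arith .add 3 3 1, .const 10 1,
    block (List.replicate d (.arith .mul 10 10 3)), .const 9 (-(2 ^ (d + 1) * M : ℕ)),
    .arith .mul 7 0 0, countdown 7 (sliceRound P), .arith .add 0 9 2]

theorem runs_power {B k : ℕ} : ∀ {d a : ℕ} {s : Store}, s.Fits B → s.reg 10 = a → s.reg 3 = k →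
    1 ≤ k → a * k ^ d ≤ B →
    Runs B (block (List.replicate d (.arith .mul 10 10 3))) s fun t s' => t ≤ d + 1 ∧
      s'.reg 10 = (a * k ^ d : ℕ) ∧ s'.Fits B ∧ (∀ x, x ≠ 10 → s'.reg x = s.reg x) ∧
      s'.mem = s.mem := by
  intro d
  induction d with
  | zero =>
    intro a s hs ha _ _ _
    simp [ha, hs]
  | succ d ih =>
    intro a s hs ha hk hk1 hB
    have e : a * k ^ (d + 1) = a * k * k ^ d := by ring
    have hak : a * k ≤ B := by
      refine le_trans ?_ (e ▸ hB)
      exact Nat.le_mul_of_pos_right _ (Nat.pow_pos hk1)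
    simp only [List.replicate_succ, runs_block_cons, runs_arith, Op.eval, ha, hk, ← Nat.cast_mul]
    refine ⟨abs_natCast_le hak, (ih (hs.setReg 10 (by rwa [Int.natAbs_natCast])) (by simp)
      (by simpa using hk) hk1 (e ▸ hB)).mono ?_⟩
    rintro t s' ⟨ht, h10, hf, hr, hm⟩
    exact ⟨by omega, by rw [h10, e], hf, fun x hx => by rw [hr x hx, Store.reg_setReg, if_neg hx],
      hm⟩

variable {B M n d τ : ℕ} {P : Prog} {A : (Fin (d + 1) → ℤ) → ℤ}

set_option maxHeartbeats 1000000 in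
-- The slice sum has entries at most `2 * M`, so its corner sums are at most `2 ^ d * (2 * M)`; the
-- factor `2` in `hMB` makes room for comparing two of them.
theorem runs_sliceRound (hB : (2 * n + 1) ^ (d + 1) ≤ B) (hnB : n * n ≤ B)
    (hMB : 2 * (2 ^ (d + 1) * M) ≤ B)
    (hP : ∀ A, ∀ s : Store, s.Fits B → CentralInput d (2 * M) n A s →
      Runs B P s fun t s' => t ≤ τ ∧ CentralOutput d n A s')
    {s : Store} (hs : s.Fits B) (hA : CentralInput (d + 1) M n A s) (h1 : s.reg 1 = 1)
    (h2 : s.reg 2 = 0) (h3 : s.reg 3 = (2 * n + 1 : ℕ)) (h10 : s.reg 10 = ((2 * n + 1) ^ d : ℕ))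
    {q : ℕ} (hq : q < n * n) (h7 : s.reg 7 = q) (h9 : |s.reg 9| ≤ (2 ^ (d + 1) * M : ℕ)) :
    Runs B (sliceRound P) s fun t s' => t ≤ τ + (2 * n + 1) ^ d * 10 + 20 ∧
      s.reg 9 ≤ s'.reg 9 ∧
      (∀ v ∈ centralCornerSums n (sliceSum A (q / n) (q % n)), v ≤ s'.reg 9) ∧
      (s'.reg 9 = s.reg 9 ∨
        s'.reg 9 ∈ centralCornerSums n (sliceSum A (q / n) (q % n))) := by
  obtain ⟨hAM, h0, hm⟩ := hA
  have hd : q / n < n := Nat.div_lt_of_lt_mul hq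
  have hn : 0 < n := (Nat.zero_le _).trans_lt hd
  have hmod : q % n < n := Nat.mod_lt _ hn
  have hdm : q / n * n ≤ q := Nat.div_mul_le_self q n
  have e : (q : ℤ) - ((q / n : ℕ) : ℤ) * n = (q % n : ℕ) := natCast_sub_div_mul q n
  have e' : (q : ℤ) / n = (q / n : ℕ) := (Int.natCast_ediv q n).symm
  have hqB : q ≤ B := by omega
  generalize q / n = x at *
  generalize q % n = y at *
  have hMd : 2 * M ≤ 2 ^ (d + 1) * M :=
    Nat.mul_le_mul_right _ (by rw [pow_succ]; have := Nat.one_le_two_pow (n := d); omega)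
  have hpd : (2 * n + 1) ^ d * (2 * n + 1) ≤ B := by rwa [← pow_succ]
  have hpd1 : 1 ≤ (2 * n + 1) ^ d := Nat.one_le_pow _ _ (by omega)
  have hn1 : 2 * n + 1 ≤ B := by nlinarith
  have hpB : (2 * n + 1) ^ d ≤ B := by nlinarith
  have hbox : ∀ w : Fin d → ℤ, InCentralBox n w →
      InCentralBox n (Fin.cons ((x : ℤ) + 1) w : Fin (d + 1) → ℤ) ∧
      InCentralBox n (Fin.cons (-((y : ℤ) + 1)) w : Fin (d + 1) → ℤ) := fun w hw =>
    ⟨inCentralBox_cons.2 ⟨⟨by omega, by omega⟩, hw⟩, inCentralBox_cons.2 ⟨⟨by omega, by omega⟩, hw⟩⟩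
  have hAM' : ∀ v, InCentralBox n v → |A v| ≤ M := fun v hv => by
    rw [Int.abs_eq_natAbs, Nat.cast_le]; exact hAM v hv
  have hSM : ∀ w, InCentralBox n w → |sliceSum A x y w| ≤ (2 * M : ℕ) := fun w hw => by
    refine (abs_add_le _ _).trans ?_
    have h1 := hAM' _ (hbox w hw).1
    have h2 := hAM' _ (hbox w hw).2
    push_cast
    linarith
  have c3 : |((x * n : ℕ) : ℤ)| ≤ B := abs_natCast_le (by omega)
  rw [Nat.cast_mul] at c3
  simp only [sliceRound, runs_block_cons, runs_arith, Op.eval,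
    Store.reg_setReg_beq, Nat.reduceBEq, cond_true, cond_false, h0, h1, h2, h7, h10, e, e',
    add_zero]
  refine ⟨abs_natCast_le (by omega), c3, abs_natCast_le (by omega), abs_le.2 ⟨by omega, by omega⟩,
    abs_le.2 ⟨by omega, by omega⟩, abs_le.2 ⟨by omega, by omega⟩, abs_le.2 ⟨by omega, by omega⟩,
    abs_natCast_le hpB, ?_⟩
  refine (runs_fill (N := (2 * n + 1) ^ d) (τ := 7) (fun p =>
    s.mem 0 ((x : ℤ) + 1 + n + (2 * n + 1) * p) + s.mem 0 (-((y : ℤ) + 1) + n + (2 * n + 1) * p))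
    (by decide) (by simp) (by simp) (by simp) ?_ (by simpa using h1) (by simp) ?_).mono ?_
  · refine (((((((hs.setReg _ ?_).setReg _ ?_).setReg _ ?_).setReg _ ?_).setReg _ ?_).setReg _
      ?_).setReg _ ?_).setReg _ ?_ <;> omega
  · intro p hp s₁ hf₁ hr₁ hm₁ l4 _
    have l3 : s₁.reg 3 = (2 * n + 1 : ℕ) := by simpa [h3] using hr₁ 3 (by decide) (by simp)
    have l11 : s₁.reg 11 = (x : ℤ) + 1 + n := by simpa using hr₁ 11 (by decide) (by simp)
    have l12 : s₁.reg 12 = (n : ℤ) - y - 1 := by simpa using hr₁ 12 (by decide) (by simp)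
    have lm : s₁.mem 0 = s.mem 0 := hm₁ 0 (by decide)
    -- The address is that of an index in the box, so the sum to be stored is bounded.
    obtain ⟨w, hw, hwp⟩ := exists_centralAddress_eq hp
    have hpn : (p + 1) * (2 * n + 1) ≤ (2 * n + 1) ^ d * (2 * n + 1) :=
      Nat.mul_le_mul_right _ hp
    have hpn' : ((p : ℤ) * (2 * n + 1 : ℕ)) + (2 * n + 1) ≤ B := by
      have : (((p + 1) * (2 * n + 1) : ℕ) : ℤ) ≤ B := by exact_mod_cast hpn.trans hpd
      push_cast at this ⊢
      linarith
    have hpn0 : 0 ≤ (p : ℤ) * (2 * n + 1 : ℕ) := by positivity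
    have a1 : (p : ℤ) * (2 * n + 1 : ℕ) + (x + 1 + n) = x + 1 + n + (2 * n + 1) * p := by
      push_cast; ring
    have a2 : (p : ℤ) * (2 * n + 1 : ℕ) + (n - y - 1) = -(y + 1) + n + (2 * n + 1) * p := by
      push_cast; ring
    simp only [runs_block_cons, runs_block_nil, runs_arith, runs_load, Op.eval,
      Store.reg_setReg_beq, Store.mem_setReg, Nat.reduceBEq, cond_true, cond_false,
      l3, l4, l11, l12, lm]
    refine ⟨abs_le.2 ⟨by omega, by omega⟩, abs_le.2 ⟨by omega, by omega⟩,
      abs_le.2 ⟨by omega, by omega⟩, ?_, by omega, by rw [a1, a2]⟩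
    rw [a1, a2, ← hwp, ← centralAddress_cons, ← centralAddress_cons, hm _ (hbox w hw).1,
      hm _ (hbox w hw).2]
    exact (hSM w hw).trans (by exact_mod_cast by omega)
  rintro t₁ s₁ ⟨ht₁, hd₁, hf₁, hr₁, hm₁⟩
  have q0 : s₁.reg 0 = n := by simpa [h0] using hr₁ 0 (by decide) (by simp)
  have q2 : s₁.reg 2 = 0 := by simpa [h2] using hr₁ 2 (by decide) (by simp)
  have q9 : s₁.reg 9 = s.reg 9 := by simpa using hr₁ 9 (by decide) (by simp)
  simp only [q0, q2, add_zero]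
  refine ⟨abs_natCast_le (by omega), ?_⟩
  have hf₁' : (s₁.setReg 16 n).Fits B := hf₁.setReg _ (by omega)
  refine (Runs.call hf₁' (hP (sliceSum A x y) ((s₁.setReg 16 n).drop 16) (hf₁'.drop 16)
    ⟨fun w hw => ?_, by simp, fun w hw => ?_⟩)).mono ?_
  · have := hSM w hw
    rwa [Int.abs_eq_natAbs, Nat.cast_le] at this
  · obtain ⟨p, hp, hwp⟩ := centralAddress_mem hw
    have := hd₁ p hp
    rw [← hwp, ← centralAddress_cons, ← centralAddress_cons, hm _ (hbox w hw).1,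
      hm _ (hbox w hw).2] at this
    exact this
  rintro t₂ s₂ ⟨⟨ht₂, hout⟩, hf₂, hr₂, hm₂⟩
  have r2 : s₂.reg 2 = 0 := by simpa [q2] using hr₂ 2 (by decide)
  have r9 : s₂.reg 9 = s.reg 9 := by simpa [q9] using hr₂ 9 (by decide)
  have hout' : IsGreatest (centralCornerSums n (sliceSum A x y)) (s₂.reg 16) := hout
  have hb := abs_le_of_mem_centralCornerSums hSM hout'.1
  have e2 : 2 ^ d * (2 * M) = 2 ^ (d + 1) * M := by ring
  rw [e2] at hb
  rw [abs_le] at hb h9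
  simp only [runs_block_nil, runs_arith, runs_branch, runs_skip, Op.eval,
    Store.reg_setReg_beq, Nat.reduceBEq, cond_true, cond_false, r2, r9, add_zero]
  refine ⟨abs_le.2 ⟨by omega, by omega⟩, ?_⟩
  split
  · exact ⟨abs_le.2 ⟨by omega, by omega⟩, by clear * - ht₁ ht₂; omega, by omega, hout'.2,
      .inr hout'.1⟩
  · exact ⟨by clear * - ht₁ ht₂; omega, le_rfl, fun v hv => (hout'.2 hv).trans (by omega),
      by simp⟩

set_option maxHeartbeats 1000000 in
theorem runs_centralSucc (hB : (2 * n + 1) ^ (d + 1) ≤ B) (hnB : n * n ≤ B)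
    (hMB : 2 * (2 ^ (d + 1) * M) ≤ B) (hn : 1 ≤ n)
    (hP : ∀ A, ∀ s : Store, s.Fits B → CentralInput d (2 * M) n A s →
      Runs B P s fun t s' => t ≤ τ ∧ CentralOutput d n A s')
    {s : Store} (hs : s.Fits B) (hA : CentralInput (d + 1) M n A s) :
    Runs B (centralSucc d M P) s fun t s' =>
      t ≤ n * n * (τ + (2 * n + 1) ^ d * 10 + 22) + d + 20 ∧ CentralOutput (d + 1) n A s' := by
  obtain ⟨hAM, h0, hm⟩ := hA
  have hAM' : ∀ v, InCentralBox n v → |A v| ≤ M := fun v hv => by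
    rw [Int.abs_eq_natAbs, Nat.cast_le]; exact hAM v hv
  have hpd : (2 * n + 1) ^ d * (2 * n + 1) ≤ B := by rwa [← pow_succ]
  have hpd1 : 1 ≤ (2 * n + 1) ^ d := Nat.one_le_pow _ _ (by omega)
  have hn1 : 2 * n + 1 ≤ B := by nlinarith
  have hpB : 1 * (2 * n + 1) ^ d ≤ B := by nlinarith
  have c1 : |(1 : ℤ)| ≤ B := abs_natCast_le (p := 1) (by omega)
  have c0 : |(0 : ℤ)| ≤ B := abs_natCast_le (p := 0) (by omega)
  have b1 : ((1 : ℤ).natAbs ≤ B) := by simp; omega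
  have b2 : ((0 : ℤ).natAbs ≤ B) := by simp
  have e3 : (n : ℤ) + n + 1 = (2 * n + 1 : ℕ) := by push_cast; ring
  simp only [centralSucc, runs_block_cons, runs_block_nil, runs_const, runs_arith, Op.eval,
    Store.reg_setReg_beq, Nat.reduceBEq, cond_true, cond_false, h0, e3]
  refine ⟨c1, c0, abs_le.2 ⟨by omega, by omega⟩, abs_natCast_le hn1, c1, ?_⟩
  refine (runs_power (a := 1) (k := 2 * n + 1) ?_ (by simp) (by simp) (by omega) hpB).mono ?_
  · refine ((((hs.setReg _ b1).setReg _ b2).setReg _ ?_).setReg _ ?_).setReg _ b1 <;> omega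
  rintro t₁ s₁ ⟨ht₁, q10, hf₁, hr₁, hm₁⟩
  rw [one_mul] at q10
  have q0 : s₁.reg 0 = n := by simpa [h0] using hr₁ 0 (by decide)
  have q1 : s₁.reg 1 = 1 := by simpa using hr₁ 1 (by decide)
  have q2 : s₁.reg 2 = 0 := by simpa using hr₁ 2 (by decide)
  have q3 : s₁.reg 3 = (2 * n + 1 : ℕ) := by simpa using hr₁ 3 (by decide)
  have hm₁' : s₁.mem = s.mem := hm₁
  simp only [q0, ← Nat.cast_mul]
  refine ⟨abs_le.2 ⟨by omega, by omega⟩, abs_natCast_le hnB, ?_⟩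
  refine (runs_countdown (N := n * n) (τ := τ + (2 * n + 1) ^ d * 10 + 20) (fun m s' =>
    (∀ q : ℕ, m ≤ q → q < n * n →
      ∀ v ∈ centralCornerSums n (sliceSum A (q / n) (q % n)), v ≤ s'.reg 9) ∧
      (s'.reg 9 = -(2 ^ (d + 1) * M : ℕ) ∨ s'.reg 9 ∈ centralCornerSums n A)) (by decide)
    (by simp [sliceRound, P.not_writesReg_shift]) (by simp [sliceRound, P.not_writesReg_shift])
    ((hf₁.setReg _ (by omega)).setReg _ (by omega)) (by simpa using q1) (by simp)
    ⟨fun p h h' => absurd h' h.not_gt, by simp⟩ ?_).mono ?_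
  · intro q hq s₂ hf₂ hr₂ hm₂ ⟨hle, hex⟩
    have hd : q / n < n := Nat.div_lt_of_lt_mul hq
    have hmod : q % n < n := Nat.mod_lt _ hn
    have r0 : s₂.reg 0 = n := by
      simpa [q0] using hr₂ 0 (by decide) (by simp [sliceRound, P.not_writesReg_shift])
    have r1 : s₂.reg 1 = 1 := by
      simpa [q1] using hr₂ 1 (by decide) (by simp [sliceRound, P.not_writesReg_shift])
    have r2 : s₂.reg 2 = 0 := by
      simpa [q2] using hr₂ 2 (by decide) (by simp [sliceRound, P.not_writesReg_shift])
    have r3 : s₂.reg 3 = (2 * n + 1 : ℕ) := by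
      simpa [q3] using hr₂ 3 (by decide) (by simp [sliceRound, P.not_writesReg_shift])
    have r10 : s₂.reg 10 = ((2 * n + 1) ^ d : ℕ) := by
      simpa [q10] using hr₂ 10 (by decide) (by simp [sliceRound, P.not_writesReg_shift])
    have rm : s₂.mem 0 = s.mem 0 := by
      rw [hm₂ 0 (by simp [sliceRound, P.not_writesMem_shift])]
      simp [hm₁']
    have r9 : |s₂.reg 9| ≤ (2 ^ (d + 1) * M : ℕ) := by
      rcases hex with h | h
      · rw [h, abs_neg, Nat.abs_cast]
      · exact abs_le_of_mem_centralCornerSums hAM' h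
    refine (runs_sliceRound (A := A) (q := q) hB hnB hMB hP (hf₂.setReg 7 (by omega))
      ⟨hAM, by simpa using r0, fun v hv => ?_⟩ (by simpa using r1) (by simpa using r2)
      (by simpa using r3) (by simpa using r10) hq (by simp) (by simpa using r9)).mono ?_
    · rw [Store.mem_setReg, rm]; exact hm v hv
    · rintro t s₃ ⟨ht, hge, hall, hor⟩
      have e9 : (s₂.setReg 7 q).reg 9 = s₂.reg 9 := by simp
      rw [e9] at hge hor
      refine ⟨ht, fun p hp hpn v hv => ?_, ?_⟩
      · rcases hp.eq_or_lt with rfl | hp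
        · exact hall v hv
        · exact (hle p hp hpn v hv).trans hge
      · rcases hor with h | h
        · rwa [h]
        · exact .inr (mem_centralCornerSums_succ.2 ⟨⟨q / n, hd⟩, ⟨q % n, hmod⟩, h⟩)
  · rintro t₂ s₂ ⟨ht₂, ⟨hle, hex⟩, hf₂, hr₂, -⟩
    have r2 : s₂.reg 2 = 0 := by
      simpa [q2] using hr₂ 2 (by decide) (by simp [sliceRound, P.not_writesReg_shift])
    have hub : ∀ v ∈ centralCornerSums n A, v ≤ s₂.reg 9 := by
      intro v hv
      obtain ⟨x, y, hv⟩ := mem_centralCornerSums_succ.1 hv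
      refine hle _ (Nat.zero_le _) (fin_mul_add_lt x y) v ?_
      rwa [fin_mul_add_div, fin_mul_add_mod]
    have h9 : s₂.reg 9 ∈ centralCornerSums n A := by
      rcases hex with h | h
      -- The start value is a lower bound for all corner sums; being also an upper bound, it equals
      -- any of them.
      · obtain ⟨v, hv⟩ := centralCornerSums_nonempty hn A
        have h1 := hub v hv
        have h2 := abs_le.1 (abs_le_of_mem_centralCornerSums hAM' hv)
        have : s₂.reg 9 = v := by omega
        rwa [this]
      · exact h
    simp only [r2, add_zero]
    refine ⟨?_, ?_, ?_⟩
    · rw [Int.abs_eq_natAbs, Nat.cast_le]; exact hf₂.1 9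
    · clear * - ht₁ ht₂
      have : n * n * (τ + (2 * n + 1) ^ d * 10 + 20 + 2) =
        n * n * (τ + (2 * n + 1) ^ d * 10 + 22) := by ring
      omega
    · rw [CentralOutput, Store.reg_setReg, if_pos rfl]
      exact ⟨h9, hub⟩

end WordRAM

/-! ### Running times and the exponent. -/

open WordRAM

theorem one_le_log_add_two {n : ℕ} (hn : 1 ≤ n) : 1 ≤ Real.log ((n : ℝ) + 2) := by
  have hn' : (1 : ℝ) ≤ n := by exact_mod_cast hn
  rw [Real.le_log_iff_exp_le (by positivity)]
  linarith [Real.exp_one_lt_d9]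

theorem WordRAM.SolvableInSoftO.mono {inst : ℕ → Type}
    {input output : (n : ℕ) → inst n → Store → Prop} {T T' : ℕ → ℝ}
    (h : SolvableInSoftO inst input output T) (hT : ∀ n, 1 ≤ n → 0 ≤ T n ∧ T n ≤ T' n) :
    SolvableInSoftO inst input output T' := by
  obtain ⟨P, w, k, C, h⟩ := h
  -- Nothing excludes a negative `C`, and monotonicity in `T` needs a nonnegative constant.
  refine ⟨P, w, k, |C|, fun n hn X B hB s hs hX => ?_⟩
  obtain ⟨t, s', he, ho, ht⟩ := h n hn X B hB s hs hX
  refine ⟨t, s', he, ho, ht.trans ?_⟩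
  have hL := one_le_log_add_two hn
  gcongr
  · exact (hT n hn).1
  · exact le_abs_self C
  · exact (hT n hn).2

/-- Lets constants depending on `d` and `M` be absorbed into the word-length exponent. -/
theorem le_add_two_pow {n N w : ℕ} (h : N ≤ w) : N ≤ (n + 2) ^ w :=
  (h.trans (Nat.lt_pow_self (by omega)).le)

theorem two_mul_add_one_pow_le {n d w : ℕ} (h : 2 * d ≤ w) : (2 * n + 1) ^ d ≤ (n + 2) ^ w := by
  refine le_trans ?_ (Nat.pow_le_pow_right (by omega) h)
  rw [pow_mul]
  exact Nat.pow_le_pow_left (by nlinarith) d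

/-- A running time for matrix multiplication is at least quadratic. -/
theorem MatMulInSoftO.sq_le {T : ℕ → ℝ} (h : MatMulInSoftO T) :
    ∃ (C : ℝ) (k : ℕ), ∀ n : ℕ, 1 ≤ n → (n : ℝ) ^ 2 ≤ C * T n * Real.log (n + 2) ^ k := by
  obtain ⟨P, w, k, C, h⟩ := h 0
  refine ⟨C, k, fun n hn => sq_le_of_matMul (c := 0) (B := (n + 2) ^ (w + 1)) ?_
    fun X s hs hX => h n hn X _ (Nat.pow_le_pow_right (by omega) (by omega)) s hs hX⟩
  exact Nat.le_self_pow (by omega) _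

theorem centralMaxSubarrayInSoftO_two {T : ℕ → ℝ} (h : MatMulInSoftO T) (M : ℕ) :
    CentralMaxSubarrayInSoftO 2 M T := by
  obtain ⟨P, w, k, C, h⟩ := h 0
  refine ⟨centralTwo M (maxPlus M P), w + (2 * M + 1) ^ 2 + 8 * M + 4, k,
    -- One multiplication costs at most `x`, and `x ≥ n ^ 2 ≥ 1` absorbs the other terms: `83 = 1 +
    -- 40 + 42`, `30 = 10 + 20`, `200 = 100 + 100`.
    (2 * ((2 * M + 1) ^ 2 * 83 + 30) + 200) * C, fun n hn A B hB s hs hA => ?_⟩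
  set x : ℝ := C * T n * Real.log (n + 2) ^ k with hx
  have hsq : (n : ℝ) ^ 2 ≤ x := sq_le_of_matMul (c := 0) (B := (n + 2) ^ (w + 1))
    (Nat.le_self_pow (by omega) _)
    fun X s hs hX => h n hn X _ (Nat.pow_le_pow_right (by omega) (by omega)) s hs hX
  have hn' : (1 : ℝ) ≤ n := by exact_mod_cast hn
  have hx1 : 1 ≤ x := le_trans (by nlinarith) hsq
  have hτ : ((⌊x⌋₊ : ℕ) : ℝ) ≤ x := Nat.floor_le (by linarith)
  have hP : ∀ X, ∀ s : Store, s.Fits B → MatMulInput 0 n X s →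
      Runs B P s fun t s' => t ≤ ⌊x⌋₊ ∧ MatMulOutput n X s' := fun X s hs hX => by
    obtain ⟨t, s', he, ho, ht⟩ := h n hn X B
      ((Nat.pow_le_pow_right (by omega) (by omega)).trans hB) s hs hX
    exact ⟨t, s', he, Nat.le_floor ht, ho⟩
  have hpow : (2 * n + 1) * (2 * n + 1) ≤ B := by
    rw [← sq]; exact (two_mul_add_one_pow_le (by omega)).trans hB
  obtain ⟨t, s', he, ht, ho⟩ := runs_centralTwo hpow ((le_add_two_pow (by omega)).trans hB) hn
    (fun X s hs hX => runs_maxPlus ((le_add_two_pow (by nlinarith)).trans hB)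
      ((le_add_two_pow (by omega)).trans hB) (by nlinarith) hP hs hn hX) hs hA
  refine ⟨t, s', he, ho, ?_⟩
  have ht' : (t : ℝ) ≤ 2 * ((2 * M + 1) ^ 2 * ((⌊x⌋₊ : ℕ) + n ^ 2 * 40 + 42) + n ^ 2 * 10 + 20) +
      n ^ 2 * 100 + 100 := by
    rw [sq (n : ℝ)]
    exact_mod_cast ht
  have h1 : (2 * (M : ℝ) + 1) ^ 2 * ((⌊x⌋₊ : ℕ) + (n : ℝ) ^ 2 * 40 + 42) ≤
      (2 * M + 1) ^ 2 * (83 * x) := by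
    gcongr
    linarith
  calc (t : ℝ) ≤ (2 * ((2 * M + 1) ^ 2 * 83 + 30) + 200) * x := by linarith
    _ = _ := by rw [hx]; ring

/-- The hypothesis `hT` pays for writing a slice sum, which has `(2 * n + 1) ^ d ≤ 3 ^ d * n ^ d`
cells. -/
theorem centralMaxSubarrayInSoftO_succ {d M k₀ : ℕ} {C₀ : ℝ} {T : ℕ → ℝ}
    (hT : ∀ n : ℕ, 1 ≤ n → (n : ℝ) ^ d ≤ C₀ * T n * Real.log (n + 2) ^ k₀)
    (h : CentralMaxSubarrayInSoftO d (2 * M) T) :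
    CentralMaxSubarrayInSoftO (d + 1) M fun n => (n : ℝ) ^ 2 * T n := by
  obtain ⟨P, w, k, C, h⟩ := h
  refine ⟨centralSucc d M P, w + 2 * (2 ^ (d + 1) * M) + 2 * (d + 1) + 2, k + k₀,
    (42 + 10 * 3 ^ d + d) * (C + C₀), fun n hn A B hB s hs hA => ?_⟩
  set L : ℝ := Real.log (n + 2) with hL
  have hL1 : 1 ≤ L := one_le_log_add_two hn
  have hn' : (1 : ℝ) ≤ n := by exact_mod_cast hn
  set y : ℝ := C * T n * L ^ k with hy
  -- The sign of `C * T n` is not given; the time bound for the zero array shows it.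
  have hy0 : 0 ≤ y := by
    obtain ⟨t, -, -, -, ht⟩ := h n hn 0 ((n + 2) ^ (w + 1))
      (Nat.pow_le_pow_right (by omega) (by omega))
      ⟨fun x => if x = 0 then n else 0, fun _ _ => 0⟩
      ⟨fun x => by
        have : n ≤ (n + 2) ^ (w + 1) := (Nat.le_add_right n 2).trans (Nat.le_self_pow (by omega) _)
        dsimp only
        split <;> simp [this], by simp⟩
      ⟨by simp, by simp, by simp⟩
    exact (Nat.cast_nonneg t).trans ht
  have hz := hT n hn
  have hz0 : (1 : ℝ) ≤ (n : ℝ) ^ d := one_le_pow₀ hn'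
  set x : ℝ := (C + C₀) * T n * L ^ (k + k₀) with hx
  have hCT : 0 ≤ C * T n := nonneg_of_mul_nonneg_left hy0 (by positivity)
  have hCT₀ : 0 ≤ C₀ * T n := nonneg_of_mul_nonneg_left ((zero_le_one.trans hz0).trans hz)
    (by positivity)
  have hxyz : y + (n : ℝ) ^ d ≤ x := by
    have h1 : y ≤ C * T n * L ^ (k + k₀) :=
      mul_le_mul_of_nonneg_left (pow_le_pow_right₀ hL1 (by omega)) hCT
    have h2 : C₀ * T n * L ^ k₀ ≤ C₀ * T n * L ^ (k + k₀) :=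
      mul_le_mul_of_nonneg_left (pow_le_pow_right₀ hL1 (by omega)) hCT₀
    have h3 : x = C * T n * L ^ (k + k₀) + C₀ * T n * L ^ (k + k₀) := by rw [hx]; ring
    linarith
  have hτ : ((⌊y⌋₊ : ℕ) : ℝ) ≤ y := Nat.floor_le hy0
  obtain ⟨t, s', he, ht, ho⟩ := runs_centralSucc (τ := ⌊y⌋₊)
    ((two_mul_add_one_pow_le (by omega)).trans hB)
    (le_trans (by
      calc n * n ≤ (n + 2) ^ 2 := by nlinarith
        _ ≤ _ := Nat.pow_le_pow_right (by omega) (by omega)) hB)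
    ((le_add_two_pow (by omega)).trans hB) hn
    (fun A s hs hA => by
      obtain ⟨t, s', he, ho, ht⟩ := h n hn A B
        ((Nat.pow_le_pow_right (by omega) (by omega)).trans hB) s hs hA
      exact ⟨t, s', he, Nat.le_floor ht, ho⟩) hs hA
  refine ⟨t, s', he, ho, ?_⟩
  have ht' : (t : ℝ) ≤ n ^ 2 * ((⌊y⌋₊ : ℕ) + (2 * n + 1) ^ d * 10 + 22) + d + 20 := by
    rw [sq (n : ℝ)]
    exact_mod_cast ht
  have h3 : (2 * (n : ℝ) + 1) ^ d ≤ 3 ^ d * x := by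
    calc (2 * (n : ℝ) + 1) ^ d ≤ (3 * n) ^ d := by gcongr; linarith
      _ = 3 ^ d * (n : ℝ) ^ d := mul_pow _ _ _
      _ ≤ 3 ^ d * x := by gcongr; linarith
  have hx1 : 1 ≤ x := by linarith
  have hnn : (1 : ℝ) ≤ (n : ℝ) ^ 2 := one_le_pow₀ hn'
  have hd : (d + 20 : ℝ) ≤ n ^ 2 * ((d + 20) * x) := by
    have : (d + 20 : ℝ) ≤ (d + 20) * x := le_mul_of_one_le_right (by positivity) hx1
    exact this.trans (le_mul_of_one_le_left (by positivity) hnn)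
  have h4 : (n : ℝ) ^ 2 * ((⌊y⌋₊ : ℕ) + (2 * n + 1) ^ d * 10 + 22) ≤
      n ^ 2 * (x + 3 ^ d * x * 10 + 21 * x) := by
    gcongr ?_ * ?_
    linarith
  calc (t : ℝ) ≤ n ^ 2 * (x + 3 ^ d * x * 10 + 21 * x) + n ^ 2 * ((d + 20) * x) := by linarith
    _ = (42 + 10 * 3 ^ d + d) * (C + C₀) * (n ^ 2 * T n) * L ^ (k + k₀) := by rw [hx]; ring

/-- `M` varies in the induction because each new coordinate doubles it. Slices are affordable since
`n ^ (e + 2) ≤ n ^ (2 * e) * n ^ 2` and `T` is at least quadratic up to logarithms. -/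
theorem centralMaxSubarrayInSoftO_add_two {T : ℕ → ℝ} (h : MatMulInSoftO T) (e : ℕ) :
    ∀ M, CentralMaxSubarrayInSoftO (e + 2) M fun n => (n : ℝ) ^ (2 * e) * T n := by
  induction e with
  | zero => simpa using centralMaxSubarrayInSoftO_two h
  | succ e ih =>
    intro M
    obtain ⟨C₀, k₀, hsq⟩ := h.sq_le
    have := centralMaxSubarrayInSoftO_succ (k₀ := k₀) (C₀ := C₀) (fun n hn => ?_) (ih (2 * M))
    · have e1 : (fun n : ℕ => (n : ℝ) ^ (2 * (e + 1)) * T n) =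
          fun n : ℕ => (n : ℝ) ^ 2 * ((n : ℝ) ^ (2 * e) * T n) := by
        funext n; ring
      rwa [e1]
    · have hn' : (1 : ℝ) ≤ n := by exact_mod_cast hn
      calc (n : ℝ) ^ (e + 2) = n ^ e * n ^ 2 := pow_add _ _ _
        _ ≤ n ^ (2 * e) * (C₀ * T n * Real.log (n + 2) ^ k₀) := by
          gcongr
          · omega
          · exact hsq n hn
        _ = _ := by ring

theorem mainTheorem11 (d : ℕ) (hd : 2 ≤ d) (M : ℕ) :
    (∀ ε : ℝ, 0 < ε →
      CentralMaxSubarrayInSoftO d M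
        (fun n => (n : ℝ) ^ (2 * (d : ℝ) - 4 + matMulExponent + ε))) ∧
    (∀ T : ℕ → ℝ, MatMulInSoftO T →
      CentralMaxSubarrayInSoftO d M (fun n => (n : ℝ) ^ (2 * (d : ℝ) - 4) * T n)) := by
  have key : ∀ T : ℕ → ℝ, MatMulInSoftO T →
      CentralMaxSubarrayInSoftO d M (fun n => (n : ℝ) ^ (2 * (d : ℝ) - 4) * T n) := by
    intro T hT
    obtain ⟨e, rfl⟩ : ∃ e, d = e + 2 := ⟨d - 2, by omega⟩
    have h := centralMaxSubarrayInSoftO_add_two hT e M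
    have e1 : 2 * ((e + 2 : ℕ) : ℝ) - 4 = ((2 * e : ℕ) : ℝ) := by push_cast; ring
    simpa only [e1, Real.rpow_natCast] using h
  refine ⟨fun ε hε => ?_, key⟩
  -- The infimum need not be attained, so an admissible exponent below `ω + ε` is used.
  obtain ⟨τ, hτ, hlt⟩ := exists_lt_of_csInf_lt (s := {τ : ℝ | MatMulInSoftO fun n => (n : ℝ) ^ τ})
    ⟨3, matMulInSoftO_cube⟩ (show matMulExponent < matMulExponent + ε by linarith)
  refine (key _ hτ).mono fun n hn => ⟨by positivity, ?_⟩
  have hn' : (1 : ℝ) ≤ n := by exact_mod_cast hn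
  rw [← Real.rpow_add (by positivity)]
  exact Real.rpow_le_rpow_of_exponent_le hn' (by linarith)
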